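/- Let $I\subseteq\mathbb R$ be an interval (of any kind, bounded or not) and let $\rho\ge 0$ be a probability density on $I$ having finite moments of all orders. For a density $\tau$ on $I$ write $S_\tau(z)=\int_I \frac{\tau(t)\,dt}{z-t}$ $(z\in\mathbb C\setminus\mathbb R)$ for its Stieltjes transform, $c_k(\tau)=\int_I x^k\tau(x)\,dx$ and $d_0(\tau)=c_2(\tau)-c_1(\tau)^2$. A probability density $\sigma$ on $I$ is called a normalized secondary density of a probability density $\tau$ on $I$ with finite second moment if $$S_\sigma(z)=\frac1{d_0(\tau)}\Bigl(z-c_1(\tau)-\frac1{S_\tau(z)}\Bigr)\qquad(z\in\mathbb C\setminus\mathbb R).$$ An $n$-th normalized secondary density of $\rho$ is the last term $\rho_n$ of a finite sequence of probability densities $\rho_0=\rho,\rho_1,\dots,\rho_n$ on $I$ in which each $\rho_{k+1}$ is a normalized secondary density of $\rho_k$. Let $(P_n)_{n\ge0}$ be polynomials with $\deg P_n=n$, orthonormal for $\langle f,g\rangle=\int_I fg\,\rho$. Let $Q_n(x)=\int_I\frac{P_n(t)-P_n(x)}{t-x}\rho(t)\,dt$ be their secondary polynomials, and let $t_n=\int_I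 xP_n(x)P_{n+1}(x)\rho(x)\,dx$ and $s_n=\int_I xP_n(x)^2\rho(x)\,dx$. Assume that for every $x\in I$ the Stieltjes–Perron inversion formula holds for $\rho$ and the reducer $\varphi$ of $\rho$ exists, i.e. $$\rho(x)=\frac1{2i\pi}\lim_{\varepsilon\to0^+}\bigl(S_\rho(x-i\varepsilon)-S_\rho(x+i\varepsilon)\bigr),\qquad \varphi(x)=\lim_{\varepsilon\to0^+}\bigl(S_\rho(x-i\varepsilon)+S_\rho(x+i\varepsilon)\bigr).$$ Then $xP_0=t_0P_1+s_0P_0$, $xP_k=t_kP_{k+1}+s_kP_k+t_{k-1}P_{k-1}$ for all $k\ge1$, and $t_k\ne0$ for all $k\ge 0$. Moreover, for every $n\ge1$ and every $n$-th normalized secondary density $\rho_n$ of $\rho$, putting $$D_{n-1}(x)=\Bigl(P_{n-1}(x)\frac{\varphi(x)}2-Q_{n-1}(x)\Bigr)^2+\pi^2\rho(x)^2P_{n-1}(x)^2,$$ one has, for almost every $x\in I$, $D_{n-1}(x)\neq0$ and $$\rho_n(x)=\frac1{t_{n-1}^2}\cdot\frac{\rho(x)}{D_{n-1}(x)}.$$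 Furthermore, at every single $x\in I$ with $D_{n-1}(x)\ne0$ the Stieltjes–Perron limit of $\rho_n$ exists and is given by the same formula: $$\frac1{2i\pi}\lim_{\varepsilon\to0^+}\bigl(S_{\rho_n}(x-i\varepsilon)-S_{\rho_n}(x+i\varepsilon)\bigr)=\frac1{t_{n-1}^2}\cdot\frac{\rho(x)}{D_{n-1}(x)}.$$ -/

import Mathlib

open MeasureTheory Filter Topology Polynomial

/-- `ρ` is a probability density on the set `I` (its values outside `I` play no role). -/
structure IsProbabilityDensityOn (I : Set ℝ) (ρ : ℝ → ℝ) : Prop where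
  nonneg : ∀ x ∈ I, 0 ≤ ρ x
  integrableOn : IntegrableOn ρ I
  integral_eq_one : ∫ x in I, ρ x = 1

/-- The Stieltjes transform `S_ρ(z) = ∫_I ρ(t) / (z - t) dt`. -/
noncomputable def stieltjes (I : Set ℝ) (ρ : ℝ → ℝ) (z : ℂ) : ℂ :=
  ∫ t in I, (ρ t : ℂ) / (z - (t : ℂ))

/-- The moment `∫_I x ^ k ρ(x) dx`. -/
noncomputable def densityMoment (I : Set ℝ) (ρ : ℝ → ℝ) (k : ℕ) : ℝ :=
  ∫ x in I, x ^ k * ρ x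

/-- `d₀ = c₂ - c₁ ^ 2`. -/
noncomputable def densityVariance (I : Set ℝ) (ρ : ℝ → ℝ) : ℝ :=
  densityMoment I ρ 2 - densityMoment I ρ 1 ^ 2

/-- `σ` is a normalized secondary density of `τ` on `I`: a probability density on `I` with
`S_σ(z) = (1 / d₀) (z - c₁ - 1 / S_τ(z))` off the real axis, where `c₁` and `d₀ = c₂ - c₁ ^ 2`
come from the (finite) first two moments of `τ`. -/
structure IsNormalizedSecondaryDensity (I : Set ℝ) (τ σ : ℝ → ℝ) : Prop where
  isProbabilityDensityOn : IsProbabilityDensityOn I σ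
  finite_second_moment : IntegrableOn (fun x => x ^ 2 * τ x) I
  stieltjes_eq : ∀ z : ℂ, z.im ≠ 0 →
    stieltjes I σ z =
      1 / (densityVariance I τ : ℂ) * (z - (densityMoment I τ 1 : ℂ) - 1 / stieltjes I τ z)

/-- `σ` is an `n`-th term of the sequence `ρ_0 = ρ, ρ_1, ρ_2, …` in which each term is a normalized
secondary density of the preceding one. -/
def IsNthSecondaryDensity (I : Set ℝ) (ρ : ℝ → ℝ) : ℕ → (ℝ → ℝ) → Prop
  | 0, σ => σ = ρ
  | n + 1, σ => ∃ τ, IsNthSecondaryDensity I ρ n τ ∧ IsNormalizedSecondaryDensity I τ σ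

/-- `P_0, P_1, …` are orthonormal polynomials for `ρ` on `I`, with `P_n` of degree `n`. -/
structure IsOrthonormalPolynomials (I : Set ℝ) (ρ : ℝ → ℝ) (P : ℕ → ℝ[X]) : Prop where
  natDegree_eq : ∀ n, (P n).natDegree = n
  orthonormal : ∀ m n,
    ∫ x in I, (P m).eval x * (P n).eval x * ρ x = if m = n then 1 else 0

/-- The secondary polynomial of `p` as a function of the real variable `x`:
`∫_I (p(t) - p(x)) / (t - x) ρ(t) dt` (the integrand's value at the single point `t = x` is
irrelevant). -/
noncomputable def secondaryPolynomial (I : Set ℝ) (ρ : ℝ → ℝ) (p : ℝ[X]) (x : ℝ) : ℝ :=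
  ∫ t in I, (p.eval t - p.eval x) / (t - x) * ρ t

/-- `t_n = ⟨x P_n, P_{n+1}⟩`. -/
noncomputable def offDiagonalCoeff (I : Set ℝ) (ρ : ℝ → ℝ) (P : ℕ → ℝ[X]) (n : ℕ) : ℝ :=
  ∫ x in I, x * (P n).eval x * (P (n + 1)).eval x * ρ x

/-- `s_n = ⟨x P_n, P_n⟩`. -/
noncomputable def diagonalCoeff (I : Set ℝ) (ρ : ℝ → ℝ) (P : ℕ → ℝ[X]) (n : ℕ) : ℝ :=
  ∫ x in I, x * (P n).eval x * (P n).eval x * ρ x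

/-- The Stieltjes–Perron quotient `(S_ρ(x - iε) - S_ρ(x + iε)) / (2iπ)` tends to `l` as
`ε → 0+`. -/
def StieltjesPerronLimit (I : Set ℝ) (ρ : ℝ → ℝ) (x l : ℝ) : Prop :=
  Tendsto (fun ε : ℝ =>
      1 / (2 * Complex.I * (Real.pi : ℂ)) *
        (stieltjes I ρ ((x : ℂ) - Complex.I * (ε : ℂ)) -
          stieltjes I ρ ((x : ℂ) + Complex.I * (ε : ℂ))))
    (𝓝[>] 0) (𝓝 (l : ℂ))

/-- The Stieltjes–Perron inversion formula recovers `ρ` at every point of `I`. -/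
def SatisfiesInversion (I : Set ℝ) (ρ : ℝ → ℝ) : Prop :=
  ∀ x ∈ I, StieltjesPerronLimit I ρ x (ρ x)

/-- `φ` is the reducer of `ρ`: `φ(x) = lim_{ε → 0+} (S_ρ(x - iε) + S_ρ(x + iε))` for all `x` in
`I`. -/
def IsReducer (I : Set ℝ) (ρ φ : ℝ → ℝ) : Prop :=
  ∀ x ∈ I, Tendsto (fun ε : ℝ =>
      stieltjes I ρ ((x : ℂ) - Complex.I * (ε : ℂ)) +
        stieltjes I ρ ((x : ℂ) + Complex.I * (ε : ℂ)))
    (𝓝[>] 0) (𝓝 (φ x : ℂ))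

/-- `(P_n(x) φ(x) / 2 - Q_n(x)) ^ 2 + π ^ 2 ρ(x) ^ 2 P_n(x) ^ 2`. -/
noncomputable def secondaryDenominator (I : Set ℝ) (ρ φ : ℝ → ℝ) (P : ℕ → ℝ[X]) (n : ℕ)
    (x : ℝ) : ℝ :=
  ((P n).eval x * (φ x / 2) - secondaryPolynomial I ρ (P n) x) ^ 2 +
    Real.pi ^ 2 * ρ x ^ 2 * (P n).eval x ^ 2

/-! Put R_n(z) = ∫ P_n(t) ρ(t) / (z - t) dt, which equals P_n S_ρ - Q_n. Since z = (z - t) + t, the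
R_n satisfy the three-term recurrence of the P_n, with the constant P_0 in place of t_{-1} R_{-1}.
The map S_τ ↦ z - 1/S_τ is then one step of a continued fraction: if S_{ρ_n} = R_n / (t_{n-1}
R_{n-1}), then z - 1/S_{ρ_n} = s_n + t_n R_{n+1}/R_n. Comparing behaviour along z = iy → ∞
identifies c_1(ρ_n) = s_n and d_0(ρ_n) = t_n², so the quotient formula propagates
(`stieltjes_nthSecondaryDensity`).

At x ± i0 the boundary values of S_ρ are φ/2 ∓ iπρ, so D_n(x) is the product of the two boundary
values of R_n. The jump of R_{n+1} / (t_n R_n) has numerator a multiple of the Casorati determinant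
P_n Q_{n+1} - P_{n+1} Q_n = 1/t_n, which gives the formula wherever D_n ≠ 0.

Two facts turn this into an almost everywhere statement about ρ_n itself. Stieltjes–Perron inversion
holds almost everywhere for any integrable density (`ae_stieltjesPerronLimit`). And D_n ≠ 0 almost
everywhere: at a zero of D_n the Casorati identity forces |S_{ρ_{n+1}}(x + iε)| → ∞, while log |1 +
i S| has Poisson averages bounded uniformly in ε, so by Fatou such blow-up is confined to a null set
(`ae_not_tendsto_norm_stieltjes_atTop`). -/

/-! ### Orthonormal polynomials for an abstract linear functional. -/

section OrthonormalSequence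

variable {L : ℝ[X] →ₗ[ℝ] ℝ} {P : ℕ → ℝ[X]}

theorem coeff_self_ne_zero_of_orthonormal (hd : ∀ n, (P n).natDegree = n)
    (ho : ∀ m n, L (P m * P n) = if m = n then 1 else 0) (n : ℕ) : (P n).coeff n ≠ 0 := by
  have h0 : P n ≠ 0 := by
    intro h
    have := ho n n
    simp [h] at this
  have := leadingCoeff_ne_zero.mpr h0
  rwa [leadingCoeff, hd] at this

theorem coeff_eq_zero_of_natDegree_eq (hd : ∀ n, (P n).natDegree = n) {n k : ℕ} (h : n < k) :
    (P n).coeff k = 0 :=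
  coeff_eq_zero_of_natDegree_lt (by rw [hd]; exact h)

/-- Subtracting a multiple of `P m` removes the top coefficient, so induction on the degree bound
applies. The bound is stated through coefficients so that the zero polynomial needs no separate
case. -/
theorem orthonormal_apply_mul_eq_zero (hd : ∀ n, (P n).natDegree = n)
    (ho : ∀ m n, L (P m * P n) = if m = n then 1 else 0) (m : ℕ) :
    ∀ p : ℝ[X], (∀ k, m ≤ k → p.coeff k = 0) → ∀ n, m ≤ n → L (p * P n) = 0 := by
  induction m with
  | zero =>
    intro p hp n _
    have : p = 0 := by ext k; simp [hp k (Nat.zero_le k)]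
    simp [this]
  | succ m ih =>
    intro p hp n hn
    have hc := coeff_self_ne_zero_of_orthonormal hd ho m
    have key := ih (p - C (p.coeff m / (P m).coeff m) * P m) (by
      intro k hk
      rcases hk.eq_or_lt with rfl | hk
      · simp only [coeff_sub, coeff_C_mul]
        field_simp
        ring
      · simp [hp k hk, coeff_eq_zero_of_natDegree_eq hd hk]) n (by omega)
    have hmn : m ≠ n := by omega
    rw [sub_mul, mul_assoc, ← smul_eq_C_mul, map_sub, map_smul, ho, if_neg hmn] at key
    simpa using key

theorem orthonormal_apply_mul_eq (hd : ∀ n, (P n).natDegree = n)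
    (ho : ∀ m n, L (P m * P n) = if m = n then 1 else 0) (n : ℕ) (p : ℝ[X])
    (hp : ∀ k, n < k → p.coeff k = 0) : L (p * P n) = p.coeff n / (P n).coeff n := by
  have hc := coeff_self_ne_zero_of_orthonormal hd ho n
  have key := orthonormal_apply_mul_eq_zero hd ho n (p - C (p.coeff n / (P n).coeff n) * P n) (by
    intro k hk
    rcases hk.eq_or_lt with rfl | hk
    · simp only [coeff_sub, coeff_C_mul]
      field_simp
      ring
    · simp [hp k hk, coeff_eq_zero_of_natDegree_eq hd hk]) n le_rfl
  rw [sub_mul, mul_assoc, ← smul_eq_C_mul, map_sub, map_smul, ho, if_pos rfl] at key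
  simpa [sub_eq_zero] using key

theorem eq_zero_of_orthonormal_apply_eq_zero (hd : ∀ n, (P n).natDegree = n)
    (ho : ∀ m n, L (P m * P n) = if m = n then 1 else 0) (n : ℕ) :
    ∀ p : ℝ[X], (∀ k, n ≤ k → p.coeff k = 0) → (∀ k < n, L (p * P k) = 0) → p = 0 := by
  induction n with
  | zero => intro p hp _; ext k; simp [hp k (Nat.zero_le k)]
  | succ n ih =>
    intro p hp h
    refine ih p (fun k hk => ?_) (fun k hk => h k (by omega))
    rcases hk.eq_or_lt with rfl | hk
    · have h1 := h n (by omega)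
      rw [orthonormal_apply_mul_eq hd ho n p (fun k hk => hp k hk)] at h1
      simpa [coeff_self_ne_zero_of_orthonormal hd ho n] using h1
    · exact hp k hk

theorem X_mul_orthonormal_zero (hd : ∀ n, (P n).natDegree = n)
    (ho : ∀ m n, L (P m * P n) = if m = n then 1 else 0) :
    X * P 0 = C (L (X * P 0 * P 1)) * P 1 + C (L (X * P 0 * P 0)) * P 0 := by
  rw [← sub_eq_zero]
  refine eq_zero_of_orthonormal_apply_eq_zero hd ho 2 _ (fun k hk => ?_) (fun k hk => ?_)
  · obtain ⟨k, rfl⟩ : ∃ j, k = j + 1 := ⟨k - 1, by omega⟩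
    simp only [coeff_sub, coeff_add, coeff_C_mul, coeff_X_mul]
    simp [coeff_eq_zero_of_natDegree_eq hd (show 0 < k by omega),
      coeff_eq_zero_of_natDegree_eq hd (show 0 < k + 1 by omega),
      coeff_eq_zero_of_natDegree_eq hd (show 1 < k + 1 by omega)]
  · simp only [sub_mul, add_mul, ← smul_eq_C_mul, smul_mul_assoc, map_sub, map_add, map_smul, ho]
    interval_cases k <;> simp

/-- The difference of the two sides has degree at most n + 2, so it suffices to pair it with `P k`
for k ≤ n + 2. For k < n the factor X moves onto `P k`, whose product with X still has degree at
most n. -/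
theorem X_mul_orthonormal_succ (hd : ∀ n, (P n).natDegree = n)
    (ho : ∀ m n, L (P m * P n) = if m = n then 1 else 0) (n : ℕ) :
    X * P (n + 1) = C (L (X * P (n + 1) * P (n + 2))) * P (n + 2) +
      C (L (X * P (n + 1) * P (n + 1))) * P (n + 1) + C (L (X * P n * P (n + 1))) * P n := by
  rw [← sub_eq_zero]
  refine eq_zero_of_orthonormal_apply_eq_zero hd ho (n + 3) _ (fun k hk => ?_) (fun k hk => ?_)
  · obtain ⟨k, rfl⟩ : ∃ j, k = j + 1 := ⟨k - 1, by omega⟩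
    simp only [coeff_sub, coeff_add, coeff_C_mul, coeff_X_mul]
    simp [coeff_eq_zero_of_natDegree_eq hd (show n + 1 < k by omega),
      coeff_eq_zero_of_natDegree_eq hd (show n < k + 1 by omega),
      coeff_eq_zero_of_natDegree_eq hd (show n + 1 < k + 1 by omega),
      coeff_eq_zero_of_natDegree_eq hd (show n + 2 < k + 1 by omega)]
  · simp only [sub_mul, add_mul, ← smul_eq_C_mul, smul_mul_assoc, map_sub, map_add, map_smul, ho]
    obtain rfl | rfl | rfl | hlt : k = n + 2 ∨ k = n + 1 ∨ k = n ∨ k < n := by omega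
    · simp
    · simp
    · simp [mul_right_comm X (P (k + 1))]
    · have : L (X * P (n + 1) * P k) = 0 := by
        rw [show X * P (n + 1) * P k = X * P k * P (n + 1) by ring]
        refine orthonormal_apply_mul_eq_zero hd ho (n + 1) _ (fun j hj => ?_) _ le_rfl
        obtain ⟨j, rfl⟩ : ∃ i, j = i + 1 := ⟨j - 1, by omega⟩
        rw [coeff_X_mul]
        exact coeff_eq_zero_of_natDegree_eq hd (by omega)
      have h1 : n + 2 ≠ k := by omega
      have h2 : n + 1 ≠ k := by omega
      have h3 : n ≠ k := by omega
      simp [this, h1, h2, h3]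

/-- Pairing X P_n with P_{n+1} reads off its top coefficient. Hence t_n is a ratio of leading
coefficients: this makes it nonzero, and later identifies the limit of z R_{n+1}/R_n. -/
theorem coeff_self_eq_mul (hd : ∀ n, (P n).natDegree = n)
    (ho : ∀ m n, L (P m * P n) = if m = n then 1 else 0) (n : ℕ) :
    (P n).coeff n = L (X * P n * P (n + 1)) * (P (n + 1)).coeff (n + 1) := by
  rw [orthonormal_apply_mul_eq hd ho (n + 1) (X * P n), coeff_X_mul,
    div_mul_cancel₀ _ (coeff_self_ne_zero_of_orthonormal hd ho (n + 1))]
  intro k hk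
  obtain ⟨k, rfl⟩ : ∃ j, k = j + 1 := ⟨k - 1, by omega⟩
  rw [coeff_X_mul]
  exact coeff_eq_zero_of_natDegree_eq hd (by omega)

theorem apply_X_mul_orthonormal_ne_zero (hd : ∀ n, (P n).natDegree = n)
    (ho : ∀ m n, L (P m * P n) = if m = n then 1 else 0) (n : ℕ) :
    L (X * P n * P (n + 1)) ≠ 0 := by
  intro h
  have := coeff_self_eq_mul hd ho n
  rw [h, zero_mul] at this
  exact coeff_self_ne_zero_of_orthonormal hd ho n this

theorem apply_X_pow_mul_orthonormal (hd : ∀ n, (P n).natDegree = n)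
    (ho : ∀ m n, L (P m * P n) = if m = n then 1 else 0) (n : ℕ) :
    L (X ^ n * P n) = 1 / (P n).coeff n := by
  rw [orthonormal_apply_mul_eq hd ho n]
  · simp
  · intro k hk
    rw [coeff_X_pow, if_neg hk.ne']

theorem apply_X_pow_mul_orthonormal_of_lt (hd : ∀ n, (P n).natDegree = n)
    (ho : ∀ m n, L (P m * P n) = if m = n then 1 else 0) {j n : ℕ} (hj : j < n) :
    L (X ^ j * P n) = 0 :=
  orthonormal_apply_mul_eq_zero hd ho n _
    (fun k hk => by rw [coeff_X_pow, if_neg (by omega)]) n le_rfl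

end OrthonormalSequence

/-! ### Analytic properties of the Stieltjes transform off the real axis. -/

section StieltjesTransform

variable {I : Set ℝ} {f g : ℝ → ℝ} {z : ℂ}

theorem abs_im_le_norm_sub_ofReal (z : ℂ) (t : ℝ) : |z.im| ≤ ‖z - t‖ := by
  simpa using Complex.abs_im_le_norm (z - t)

theorem sub_ofReal_ne_zero (hz : z.im ≠ 0) (t : ℝ) : z - t ≠ 0 := by
  intro h
  have := congrArg Complex.im h
  simp at this
  exact hz this

theorem aestronglyMeasurable_stieltjes_integrand (hf : IntegrableOn f I) (z : ℂ) :
    AEStronglyMeasurable (fun t : ℝ => (f t : ℂ) / (z - t)) (volume.restrict I) := by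
  have h1 : AEStronglyMeasurable (fun t : ℝ => (f t : ℂ)) (volume.restrict I) :=
    hf.ofReal.aestronglyMeasurable
  have h2 : Measurable (fun t : ℝ => (z - (t : ℂ))⁻¹) := by fun_prop
  simp only [div_eq_mul_inv]
  exact h1.mul h2.aestronglyMeasurable

theorem norm_stieltjes_integrand_le (hz : z.im ≠ 0) (t : ℝ) :
    ‖(f t : ℂ) / (z - t)‖ ≤ |f t| / |z.im| := by
  rw [norm_div, Complex.norm_real, Real.norm_eq_abs]
  have := abs_pos.mpr hz
  gcongr
  exact abs_im_le_norm_sub_ofReal z t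

theorem integrableOn_stieltjes_integrand (hf : IntegrableOn f I) (hz : z.im ≠ 0) :
    IntegrableOn (fun t : ℝ => (f t : ℂ) / (z - t)) I :=
  (hf.abs.div_const |z.im|).mono' (aestronglyMeasurable_stieltjes_integrand hf z)
    (ae_of_all _ (norm_stieltjes_integrand_le hz))

theorem norm_stieltjes_le (hf : IntegrableOn f I) (hz : z.im ≠ 0) :
    ‖stieltjes I f z‖ ≤ (∫ t in I, |f t|) / |z.im| := by
  rw [← integral_div]
  exact norm_integral_le_of_norm_le (hf.abs.div_const _)
    (ae_of_all _ (norm_stieltjes_integrand_le hz))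

theorem stieltjes_add (hf : IntegrableOn f I) (hg : IntegrableOn g I) (hz : z.im ≠ 0) :
    stieltjes I (fun t => f t + g t) z = stieltjes I f z + stieltjes I g z := by
  unfold stieltjes
  rw [← integral_add (integrableOn_stieltjes_integrand hf hz)
    (integrableOn_stieltjes_integrand hg hz)]
  simp [add_div]

theorem stieltjes_const_mul (c : ℝ) : stieltjes I (fun t => c * f t) z = c * stieltjes I f z := by
  unfold stieltjes
  rw [← integral_const_mul]
  simp [mul_div_assoc]

/-- Write z = (z - t) + t under the integral; every recurrence for transforms below comes from this.
-/
theorem mul_stieltjes (hf : IntegrableOn f I) (hf' : IntegrableOn (fun t => t * f t) I)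
    (hz : z.im ≠ 0) :
    z * stieltjes I f z = stieltjes I (fun t => t * f t) z + ((∫ t in I, f t : ℝ) : ℂ) := by
  unfold stieltjes
  rw [← integral_const_mul, ← integral_complex_ofReal]
  refine Eq.trans ?_ (integral_add (integrableOn_stieltjes_integrand hf' hz) hf.ofReal)
  refine integral_congr_ae (ae_of_all _ fun t => ?_)
  have := sub_ofReal_ne_zero hz t
  push_cast
  field_simp
  ring

theorem hasDerivAt_stieltjes (hf : IntegrableOn f I) (hz : z.im ≠ 0) :
    HasDerivAt (stieltjes I f) (∫ t in I, -((f t : ℂ) / (z - t) ^ 2)) z := by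
  have hpos := abs_pos.mpr hz
  have hnear : ∀ᶠ w : ℂ in 𝓝 z, |z.im| / 2 < |w.im| :=
    (Complex.continuous_im.abs.tendsto z).eventually (lt_mem_nhds (half_lt_self hpos))
  have hne : ∀ w : ℂ, |z.im| / 2 < |w.im| → w.im ≠ 0 := fun w hw =>
    abs_pos.mp ((half_pos hpos).trans hw)
  refine (hasDerivAt_integral_of_dominated_loc_of_deriv_le (μ := volume.restrict I)
    (F := fun (w : ℂ) (t : ℝ) => (f t : ℂ) / (w - t))
    (F' := fun (w : ℂ) (t : ℝ) => -((f t : ℂ) / (w - t) ^ 2))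
    (bound := fun t => |f t| / (|z.im| / 2) ^ 2) hnear
    (Eventually.of_forall fun w => aestronglyMeasurable_stieltjes_integrand hf w)
    (integrableOn_stieltjes_integrand hf hz) ?_ ?_ (hf.abs.div_const _) ?_).2
  · have h1 : AEStronglyMeasurable (fun t : ℝ => (f t : ℂ)) (volume.restrict I) :=
      hf.ofReal.aestronglyMeasurable
    have h2 : Measurable (fun t : ℝ => ((z - (t : ℂ)) ^ 2)⁻¹) := by fun_prop
    simp only [div_eq_mul_inv]
    exact (h1.mul h2.aestronglyMeasurable).neg
  · refine ae_of_all _ fun t w hw => ?_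
    rw [norm_neg, norm_div, norm_pow, Complex.norm_real, Real.norm_eq_abs]
    have : |z.im| / 2 ≤ ‖w - t‖ := (le_of_lt hw).trans (abs_im_le_norm_sub_ofReal w t)
    gcongr
  · refine ae_of_all _ fun t w hw => ?_
    have h0 := sub_ofReal_ne_zero (hne w hw) t
    have := (((hasDerivAt_id w).sub_const (t : ℂ)).inv h0).const_mul (f t : ℂ)
    simp only [div_eq_mul_inv]
    exact this.congr_deriv (by simp [div_eq_mul_inv])

theorem tendsto_mul_stieltjes_atTop (hf : IntegrableOn f I) :
    Tendsto (fun y : ℝ => (Complex.I * y) * stieltjes I f (Complex.I * y)) atTop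
      (𝓝 ((∫ t in I, f t : ℝ) : ℂ)) := by
  have hcongr : (fun y : ℝ => (Complex.I * y) * stieltjes I f (Complex.I * y)) =
      fun y : ℝ => ∫ t in I, (Complex.I * y) * ((f t : ℂ) / (Complex.I * y - t)) := by
    funext y
    rw [stieltjes, integral_const_mul]
  rw [hcongr, ← integral_complex_ofReal]
  refine tendsto_integral_filter_of_dominated_convergence (fun t => |f t|)
    (Eventually.of_forall fun y =>
      (aestronglyMeasurable_stieltjes_integrand hf _).const_mul _) ?_ hf.abs ?_
  · filter_upwards [eventually_gt_atTop 0] with y hy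
    refine ae_of_all _ fun t => ?_
    have him : (Complex.I * (y : ℂ)).im = y := by simp
    have h1 : |y| ≤ ‖Complex.I * (y : ℂ) - t‖ := by
      simpa [him] using abs_im_le_norm_sub_ofReal (Complex.I * (y : ℂ)) t
    have hy' : 0 < |y| := abs_pos.mpr hy.ne'
    rw [norm_mul, norm_div, norm_mul, Complex.norm_I, one_mul, Complex.norm_real,
      Complex.norm_real, Real.norm_eq_abs, Real.norm_eq_abs, mul_div_left_comm]
    refine mul_le_of_le_one_right (abs_nonneg _) ?_
    exact div_le_one_of_le₀ h1 (norm_nonneg _)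
  · refine ae_of_all _ fun t => ?_
    have h1 : Tendsto (fun y : ℝ => (t : ℂ) * (((y⁻¹ : ℝ) : ℂ)) * Complex.I) atTop (𝓝 0) := by
      have := (Complex.continuous_ofReal.tendsto 0).comp tendsto_inv_atTop_zero
      simpa using (this.const_mul (t : ℂ)).mul_const Complex.I
    have h2 : Tendsto (fun y : ℝ => (f t : ℂ) / (1 + (t : ℂ) * (((y⁻¹ : ℝ) : ℂ)) * Complex.I))
        atTop (𝓝 (f t : ℂ)) := by
      have := (tendsto_const_nhds (x := (f t : ℂ)) (f := atTop)).div (h1.const_add 1) (by simp)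
      rw [add_zero, div_one] at this
      exact this
    refine h2.congr' ?_
    filter_upwards [eventually_gt_atTop 0] with y hy
    have hy' : (y : ℂ) ≠ 0 := by exact_mod_cast hy.ne'
    have h3 : Complex.I * (y : ℂ) - t ≠ 0 := sub_ofReal_ne_zero (by simpa using hy.ne') t
    have h4 : 1 + (t : ℂ) * (((y⁻¹ : ℝ) : ℂ)) * Complex.I =
        (Complex.I * y - t) / (Complex.I * y) := by
      push_cast
      field_simp
      linear_combination (t : ℂ) * Complex.I_sq
    rw [h4]
    field_simp

theorem stieltjes_im_eq (hf : IntegrableOn f I) (hz : z.im ≠ 0) :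
    (stieltjes I f z).im = -z.im * ∫ t in I, f t / Complex.normSq (z - t) := by
  have h := integral_im (𝕜 := ℂ) (integrableOn_stieltjes_integrand hf hz)
  simp only [RCLike.im_eq_complex_im] at h
  rw [stieltjes, ← h, ← integral_const_mul]
  refine integral_congr_ae (ae_of_all _ fun t => ?_)
  simp [Complex.div_im]
  ring

/-- If the integral vanished, f would vanish almost everywhere on I, contradicting total mass 1. The
strict sign makes S_f zero-free and sends the upper half-plane to the lower one. -/
theorem integral_div_normSq_pos (hf : IsProbabilityDensityOn I f) (hI : MeasurableSet I)
    (hz : z.im ≠ 0) : 0 < ∫ t in I, f t / Complex.normSq (z - t) := by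
  have hnn : ∀ᵐ t ∂volume.restrict I, 0 ≤ f t :=
    (ae_restrict_iff' hI).mpr (ae_of_all _ hf.nonneg)
  have hsq : ∀ t : ℝ, 0 < Complex.normSq (z - t) := fun t =>
    Complex.normSq_pos.mpr (sub_ofReal_ne_zero hz t)
  have hint : IntegrableOn (fun t => f t / Complex.normSq (z - t)) I := by
    refine (hf.integrableOn.abs.div_const (|z.im| ^ 2)).mono' ?_ (ae_of_all _ fun t => ?_)
    · have h2 : Measurable (fun t : ℝ => (Complex.normSq (z - (t : ℂ)))⁻¹) := by
        have : Continuous (fun t : ℝ => Complex.normSq (z - (t : ℂ))) := by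
          exact Complex.continuous_normSq.comp (by fun_prop)
        exact this.measurable.inv
      simp only [div_eq_mul_inv]
      exact hf.integrableOn.aestronglyMeasurable.mul h2.aestronglyMeasurable
    · rw [norm_div, Real.norm_eq_abs, Real.norm_eq_abs, abs_of_pos (hsq t), Complex.normSq_eq_norm_sq]
      have := abs_pos.mpr hz
      gcongr
      exact abs_im_le_norm_sub_ofReal z t
  have hge : 0 ≤ᵐ[volume.restrict I] fun t => f t / Complex.normSq (z - t) := by
    filter_upwards [hnn] with t ht using div_nonneg ht (hsq t).le
  refine lt_of_le_of_ne (integral_nonneg_of_ae hge) fun h0 => ?_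
  have h1 := (integral_eq_zero_iff_of_nonneg_ae hge hint).mp h0.symm
  have h2 : ∫ t in I, f t = 0 := integral_eq_zero_of_ae (by
    filter_upwards [h1] with t ht
    simpa [(hsq t).ne'] using ht)
  rw [hf.integral_eq_one] at h2
  exact one_ne_zero h2

theorem stieltjes_ne_zero (hf : IsProbabilityDensityOn I f) (hI : MeasurableSet I)
    (hz : z.im ≠ 0) : stieltjes I f z ≠ 0 := by
  intro h
  have := stieltjes_im_eq hf.integrableOn hz
  rw [h, Complex.zero_im] at this
  exact mul_ne_zero (neg_ne_zero.mpr hz) (integral_div_normSq_pos hf hI hz).ne' this.symm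

theorem stieltjes_im_neg (hf : IsProbabilityDensityOn I f) (hI : MeasurableSet I)
    (hz : 0 < z.im) : (stieltjes I f z).im < 0 := by
  rw [stieltjes_im_eq hf.integrableOn hz.ne', neg_mul, neg_lt_zero]
  exact mul_pos hz (integral_div_normSq_pos hf hI hz.ne')

theorem norm_stieltjes_le_inv (hf : IsProbabilityDensityOn I f) (hI : MeasurableSet I)
    (hz : z.im ≠ 0) : ‖stieltjes I f z‖ ≤ |z.im|⁻¹ := by
  refine (norm_stieltjes_le hf.integrableOn hz).trans_eq ?_
  rw [setIntegral_congr_fun hI fun t ht => abs_of_nonneg (hf.nonneg t ht), hf.integral_eq_one,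
    one_div]

end StieltjesTransform

/-! ### The Poisson formula at i for bounded analytic functions on the closed upper half-plane. -/

section HalfPlane

theorem norm_sq_div_two_le_norm_sq_add_one {z : ℂ} (hz : 2 ≤ ‖z‖) :
    ‖z‖ ^ 2 / 2 ≤ ‖z ^ 2 + 1‖ := by
  have h1 : ‖z ^ 2‖ ≤ ‖z ^ 2 + 1‖ + 1 := by
    have := norm_sub_le (z ^ 2 + 1) 1
    simpa using this
  rw [norm_pow] at h1
  nlinarith

theorem integrable_div_sq_add_one {h : ℝ → ℂ} (hc : Continuous h) {C : ℝ}
    (hb : ∀ x, ‖h x‖ ≤ C) : Integrable fun x : ℝ => h x / ((x : ℂ) ^ 2 + 1) := by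
  refine (integrable_inv_one_add_sq.const_mul C).mono' ?_ (ae_of_all _ fun x => ?_)
  · have : Measurable fun x : ℝ => ((x : ℂ) ^ 2 + 1)⁻¹ := by fun_prop
    simp only [div_eq_mul_inv]
    exact (hc.measurable.mul this).aestronglyMeasurable
  · have hx : (x : ℂ) ^ 2 + 1 = ((1 + x ^ 2 : ℝ) : ℂ) := by push_cast; ring
    have hp : 0 < 1 + x ^ 2 := by positivity
    rw [norm_div, hx, Complex.norm_real, Real.norm_eq_abs, abs_of_pos hp, div_eq_mul_inv]
    gcongr
    exact hb x

/-- Subtracting g(i) removes the pole of 1/(z² + 1) at i. Cauchy's theorem on the rectangle with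
corners -R and R + iR then leaves three edges of total length 4R, on which the integrand is O(1/R²).
-/
theorem integral_sub_apply_I_div_sq_add_one_eq_zero {g : ℂ → ℂ} {M : ℝ}
    (hd : ∀ z : ℂ, 0 ≤ z.im → DifferentiableAt ℂ g z) (hb : ∀ z : ℂ, 0 ≤ z.im → ‖g z‖ ≤ M) :
    ∫ x : ℝ, (g x - g Complex.I) / ((x : ℂ) ^ 2 + 1) = 0 := by
  -- Off i this is (g z - g i)/(z² + 1); `dslope` supplies the removable value at i.
  set k : ℂ → ℂ := fun z => dslope g Complex.I z / (z + Complex.I) with hk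
  have hM : 0 ≤ M := (norm_nonneg _).trans (hb 0 (by simp))
  have hfac : ∀ z : ℂ, z ^ 2 + 1 = (z - Complex.I) * (z + Complex.I) := fun z => by
    linear_combination Complex.I_sq
  have hkeq : ∀ z : ℂ, z ≠ Complex.I → k z = (g z - g Complex.I) / (z ^ 2 + 1) := by
    intro z hz
    simp only [hk]
    rw [dslope_of_ne _ hz, slope_def_field, hfac, div_div]
  have hdiff : ∀ z : ℂ, 0 ≤ z.im → DifferentiableAt ℂ k z := by
    intro z hz
    have hne : z + Complex.I ≠ 0 := by
      intro h
      have := congrArg Complex.im h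
      simp at this
      linarith
    refine DifferentiableAt.div ?_ (by fun_prop) hne
    by_cases hzI : z = Complex.I
    · have ho : {w : ℂ | 0 < w.im} ∈ 𝓝 z :=
        (isOpen_lt continuous_const Complex.continuous_im).mem_nhds (by simp [hzI])
      have : DifferentiableOn ℂ (dslope g Complex.I) {w : ℂ | 0 < w.im} := by
        rw [Complex.differentiableOn_dslope (hzI ▸ ho)]
        exact fun w hw => (hd w (le_of_lt hw)).differentiableWithinAt
      exact this.differentiableAt ho
    · exact (differentiableAt_dslope_of_ne hzI).mpr (hd z hz)
  have hreal : ∀ x : ℝ, (x : ℂ) ≠ Complex.I := fun x h => by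
    have := congrArg Complex.im h
    simp at this
  have hkreal : ∀ x : ℝ, k x = (g x - g Complex.I) / ((x : ℂ) ^ 2 + 1) := fun x => hkeq _ (hreal x)
  have hbI : ∀ z : ℂ, 0 ≤ z.im → ‖g z - g Complex.I‖ ≤ 2 * M := fun z hz => by
    have := norm_sub_le (g z) (g Complex.I)
    have h1 := hb z hz
    have h2 := hb Complex.I (by simp)
    linarith
  have hint : Integrable fun x : ℝ => k x := by
    simp only [hkreal]
    refine integrable_div_sq_add_one (h := fun x : ℝ => g x - g Complex.I) (C := 2 * M) ?_
      fun x => hbI _ (by simp)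
    refine continuous_iff_continuousAt.mpr fun x => ?_
    have : ContinuousAt g (x : ℂ) := (hd x (by simp)).continuousAt
    exact (this.comp (f := fun x : ℝ => (x : ℂ)) Complex.continuous_ofReal.continuousAt).sub
      continuousAt_const
  have hkb : ∀ R : ℝ, 2 ≤ R → ∀ z : ℂ, 0 ≤ z.im → R ≤ ‖z‖ → ‖k z‖ ≤ 4 * M / R ^ 2 := by
    intro R hR z hz hRz
    have hzI : z ≠ Complex.I := by
      rintro rfl
      rw [Complex.norm_I] at hRz
      linarith
    rw [hkeq z hzI, norm_div]
    have h1 := norm_sq_div_two_le_norm_sq_add_one (hR.trans hRz)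
    have h2 : R ^ 2 / 2 ≤ ‖z ^ 2 + 1‖ := le_trans (by gcongr) h1
    calc ‖g z - g Complex.I‖ / ‖z ^ 2 + 1‖ ≤ 2 * M / (R ^ 2 / 2) := by
          gcongr
          exact hbI z hz
      _ = 4 * M / R ^ 2 := by field_simp; ring
  have hrect : ∀ R : ℝ, 2 ≤ R → ‖∫ x in (-R)..R, k x‖ ≤ 16 * M / R := by
    intro R hR
    have hR0 : 0 < R := by linarith
    have hc := Complex.integral_boundary_rect_eq_zero_of_differentiableOn k (-R : ℂ)
      (R + R * Complex.I) (by
        intro z hz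
        refine (hdiff z ?_).differentiableWithinAt
        have := hz.2
        simp [Set.uIcc_of_le hR0.le] at this
        exact this.1)
    simp only [Complex.neg_re, Complex.ofReal_re, Complex.neg_im, Complex.ofReal_im, neg_zero,
      Complex.add_re, Complex.mul_re, Complex.I_re, mul_zero, Complex.I_im, mul_one, sub_self,
      add_zero, Complex.add_im, Complex.mul_im, zero_add, Complex.ofReal_zero, zero_mul] at hc
    have htop : ‖∫ x in (-R)..R, k (x + R * Complex.I)‖ ≤ 4 * M / R ^ 2 * |R - -R| := by
      refine intervalIntegral.norm_integral_le_of_norm_le_const fun x _ => hkb R hR _ ?_ ?_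
      · simpa using hR0.le
      · have := Complex.abs_im_le_norm (x + R * Complex.I)
        simp [abs_of_pos hR0] at this
        exact this
    have hside : ∀ a : ℝ, |a| = R → ‖∫ y in (0 : ℝ)..R, k (a + y * Complex.I)‖ ≤
        4 * M / R ^ 2 * |R - 0| := by
      intro a ha
      refine intervalIntegral.norm_integral_le_of_norm_le_const fun y hy => hkb R hR _ ?_ ?_
      · rw [Set.uIoc_of_le hR0.le] at hy
        simpa using hy.1.le
      · have := Complex.abs_re_le_norm (a + y * Complex.I)
        simp [ha] at this
        exact this
    have h1 := hside R (abs_of_pos hR0)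
    have h2 := hside (-R) (by rw [abs_neg, abs_of_pos hR0])
    have hE : ∫ x in (-R)..R, k x = (∫ x in (-R)..R, k (x + R * Complex.I)) -
        Complex.I * (∫ y in (0 : ℝ)..R, k (R + y * Complex.I)) +
        Complex.I * (∫ y in (0 : ℝ)..R, k ((-R : ℝ) + y * Complex.I)) := by
      simp only [smul_eq_mul] at hc
      linear_combination hc
    rw [hE]
    refine (norm_add_le _ _).trans ?_
    refine (add_le_add_left (norm_sub_le _ _) _).trans ?_
    rw [norm_mul, norm_mul, Complex.norm_I, one_mul, one_mul]
    have e1 : |R - -R| = 2 * R := by rw [abs_of_pos] <;> linarith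
    have e2 : |R - 0| = R := by rw [sub_zero, abs_of_pos hR0]
    rw [e1] at htop
    rw [e2] at h1 h2
    have e3 : 4 * M / R ^ 2 * (2 * R) + 4 * M / R ^ 2 * R + 4 * M / R ^ 2 * R = 16 * M / R := by
      field_simp
      ring
    linarith
  have hlim1 : Tendsto (fun R : ℝ => ∫ x in (-R)..R, k x) atTop (𝓝 (∫ x : ℝ, k x)) :=
    intervalIntegral_tendsto_integral hint tendsto_neg_atTop_atBot tendsto_id
  have hlim2 : Tendsto (fun R : ℝ => ∫ x in (-R)..R, k x) atTop (𝓝 0) := by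
    refine squeeze_zero_norm' ((eventually_ge_atTop 2).mono hrect) ?_
    exact tendsto_const_nhds.div_atTop tendsto_id
  rw [← tendsto_nhds_unique hlim1 hlim2]
  simp only [hkreal]

theorem integral_re_div_one_add_sq {g : ℂ → ℂ} {M : ℝ}
    (hd : ∀ z : ℂ, 0 ≤ z.im → DifferentiableAt ℂ g z) (hb : ∀ z : ℂ, 0 ≤ z.im → ‖g z‖ ≤ M) :
    Integrable (fun x : ℝ => (g x).re / (1 + x ^ 2)) ∧
      ∫ x : ℝ, (g x).re / (1 + x ^ 2) = Real.pi * (g Complex.I).re := by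
  have hre : ∀ (c : ℂ) (x : ℝ), (c / ((x : ℂ) ^ 2 + 1)).re = c.re / (1 + x ^ 2) := by
    intro c x
    have : (x : ℂ) ^ 2 + 1 = ((1 + x ^ 2 : ℝ) : ℂ) := by push_cast; ring
    rw [this, Complex.div_ofReal_re]
  have hc : Continuous fun x : ℝ => g x := by
    refine continuous_iff_continuousAt.mpr fun x => ?_
    have : ContinuousAt g (x : ℂ) := (hd x (by simp)).continuousAt
    exact this.comp (f := fun x : ℝ => (x : ℂ)) Complex.continuous_ofReal.continuousAt
  have h1 := integrable_div_sq_add_one hc (C := M) fun x => hb _ (by simp)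
  have h2 := integrable_div_sq_add_one (h := fun _ => g Complex.I) continuous_const
    (C := ‖g Complex.I‖) fun x => le_rfl
  have h0 := integral_sub_apply_I_div_sq_add_one_eq_zero hd hb
  simp only [sub_div] at h0
  rw [integral_sub h1 h2, sub_eq_zero] at h0
  have r1 := integral_re (𝕜 := ℂ) h1
  have r2 := integral_re (𝕜 := ℂ) h2
  simp only [RCLike.re_eq_complex_re, hre] at r1 r2
  refine ⟨by simpa only [RCLike.re_eq_complex_re, hre] using h1.re, ?_⟩
  rw [r1, h0, ← r2]
  simp only [div_eq_mul_inv]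
  rw [integral_const_mul, integral_univ_inv_one_add_sq, mul_comm]

end HalfPlane

/-! ### The Stieltjes transform tends to infinity only over a null set of real points. -/

section BoundaryGrowth

variable {I : Set ℝ} {f : ℝ → ℝ}

/-- Re(1 + iS) = 1 - Im S, and Im S < 0 in the upper half-plane. So the principal logarithm of 1 +
iS is analytic there, with nonnegative real part. -/
theorem one_le_norm_one_add_I_mul_stieltjes (hf : IsProbabilityDensityOn I f)
    (hI : MeasurableSet I) {z : ℂ} (hz : 0 < z.im) :
    1 ≤ (1 + Complex.I * stieltjes I f z).re ∧ 1 ≤ ‖1 + Complex.I * stieltjes I f z‖ ∧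
      ‖1 + Complex.I * stieltjes I f z‖ ≤ 1 + z.im⁻¹ := by
  have h1 : 1 ≤ (1 + Complex.I * stieltjes I f z).re := by
    simpa using (stieltjes_im_neg hf hI hz).le
  refine ⟨h1, h1.trans (Complex.re_le_norm _), ?_⟩
  refine (norm_add_le _ _).trans ?_
  have := norm_stieltjes_le_inv hf hI hz.ne'
  rw [abs_of_pos hz] at this
  simpa using this

/-- The Poisson formula at i is applied to log(1 + iS(z + iε)); the shift by iε makes it analytic
and bounded on the closed half-plane. Its real part at i is at most log(1 + 1/(1 + ε)) ≤ log 2. The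
point is that the bound does not depend on ε. -/
theorem integral_log_norm_one_add_I_mul_stieltjes (hf : IsProbabilityDensityOn I f)
    (hI : MeasurableSet I) {ε : ℝ} (hε : 0 < ε) :
    Integrable (fun x : ℝ =>
        Real.log ‖1 + Complex.I * stieltjes I f (x + Complex.I * ε)‖ / (1 + x ^ 2)) ∧
      ∫ x : ℝ, Real.log ‖1 + Complex.I * stieltjes I f (x + Complex.I * ε)‖ / (1 + x ^ 2) ≤
        Real.pi * Real.log 2 := by
  have him : ∀ z : ℂ, 0 ≤ z.im → ε ≤ (z + Complex.I * ε).im := fun z hz => by simpa using hz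
  have hbd : ∀ z : ℂ, 0 ≤ z.im →
      1 ≤ ‖1 + Complex.I * stieltjes I f (z + Complex.I * ε)‖ ∧
        ‖1 + Complex.I * stieltjes I f (z + Complex.I * ε)‖ ≤ 1 + ε⁻¹ := fun z hz => by
    have h1 := one_le_norm_one_add_I_mul_stieltjes hf hI (hε.trans_le (him z hz))
    refine ⟨h1.2.1, h1.2.2.trans ?_⟩
    have := him z hz
    gcongr
  have key := integral_re_div_one_add_sq
    (g := fun z => Complex.log (1 + Complex.I * stieltjes I f (z + Complex.I * ε)))
    (M := Real.log (1 + ε⁻¹) + Real.pi) (fun z hz => ?_) (fun z hz => ?_)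
  · simp only [Complex.log_re] at key
    refine ⟨key.1, key.2.trans_le ?_⟩
    gcongr
    · exact one_pos.trans_le (hbd Complex.I (by simp)).1
    · refine (one_le_norm_one_add_I_mul_stieltjes hf hI
        (hε.trans_le (him Complex.I (by simp)))).2.2.trans ?_
      have : (1 + ε)⁻¹ ≤ 1 := inv_le_one_of_one_le₀ (by linarith)
      simp
      linarith
  · have hz' := hε.trans_le (him z hz)
    refine DifferentiableAt.clog ?_ ?_
    · have h1 := (hasDerivAt_stieltjes hf.integrableOn hz'.ne').differentiableAt
      have h2 : DifferentiableAt ℂ (fun z : ℂ => z + Complex.I * ε) z := by fun_prop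
      have h3 : DifferentiableAt ℂ (fun z : ℂ => stieltjes I f (z + Complex.I * ε)) z :=
        DifferentiableAt.comp z (g := stieltjes I f) h1 h2
      exact (h3.const_mul _).const_add _
    · exact Or.inl (one_pos.trans_le (one_le_norm_one_add_I_mul_stieltjes hf hI hz').1)
  · refine (Complex.norm_le_abs_re_add_abs_im _).trans ?_
    rw [Complex.log_re, Complex.log_im]
    obtain ⟨h1, h2⟩ := hbd z hz
    refine add_le_add ?_ (Complex.abs_arg_le_pi _)
    rw [abs_of_nonneg (Real.log_nonneg h1)]
    exact Real.log_le_log (one_pos.trans_le h1) h2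

/-- Fatou along ε = 1/(k + 1): the lower limit of the nonnegative functions log |1 + iS| / (1 + x²)
has finite integral, hence is finite almost everywhere, whereas |S| → ∞ at x would make it infinite
there. -/
theorem ae_not_tendsto_norm_stieltjes_atTop (hf : IsProbabilityDensityOn I f)
    (hI : MeasurableSet I) :
    ∀ᵐ x : ℝ, ¬ Tendsto (fun ε : ℝ => ‖stieltjes I f (x + Complex.I * ε)‖) (𝓝[>] 0) atTop := by
  set e : ℕ → ℝ := fun k => 1 / ((k : ℝ) + 1) with he
  have hepos : ∀ k, 0 < e k := fun k => by simp only [he]; positivity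
  have hetend : Tendsto e atTop (𝓝[>] 0) :=
    tendsto_nhdsWithin_iff.mpr
      ⟨tendsto_one_div_add_atTop_nhds_zero_nat, Eventually.of_forall hepos⟩
  set u : ℕ → ℝ → ℝ := fun k x =>
    Real.log ‖1 + Complex.I * stieltjes I f (x + Complex.I * e k)‖ / (1 + x ^ 2) with hu
  have hint := fun k => integral_log_norm_one_add_I_mul_stieltjes hf hI (hepos k)
  have hu0 : ∀ k x, 0 ≤ u k x := fun k x =>
    div_nonneg (Real.log_nonneg
      (one_le_norm_one_add_I_mul_stieltjes hf hI (by simpa using hepos k)).2.1) (by positivity)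
  have hmeas : ∀ k, Measurable (fun x => ENNReal.ofReal (u k x)) := fun k => by
    have hc : Continuous fun x : ℝ => stieltjes I f (x + Complex.I * e k) :=
      continuous_iff_continuousAt.mpr fun x => ContinuousAt.comp (g := stieltjes I f)
        (f := fun x : ℝ => (x : ℂ) + Complex.I * e k)
        (hasDerivAt_stieltjes hf.integrableOn (by simpa using (hepos k).ne')).continuousAt
        (by fun_prop)
    have hm := hc.measurable
    fun_prop
  have hle : ∀ k, ∫⁻ x, ENNReal.ofReal (u k x) ≤ ENNReal.ofReal (Real.pi * Real.log 2) := fun k => by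
    rw [← ofReal_integral_eq_lintegral_ofReal (hint k).1 (ae_of_all _ (hu0 k))]
    exact ENNReal.ofReal_le_ofReal (hint k).2
  have hfatou : ∫⁻ x, liminf (fun k => ENNReal.ofReal (u k x)) atTop ≠ ⊤ := by
    refine ne_top_of_le_ne_top (b := ENNReal.ofReal (Real.pi * Real.log 2))
      ENNReal.ofReal_ne_top ((lintegral_liminf_le hmeas).trans ?_)
    refine (liminf_le_liminf (Eventually.of_forall hle)).trans_eq ?_
    simp
  have hfin := ae_lt_top (Measurable.liminf hmeas) hfatou
  filter_upwards [hfin] with x hx hx'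
  have h1 := hx'.comp hetend
  have h2 : Tendsto (fun k => ‖1 + Complex.I * stieltjes I f (x + Complex.I * e k)‖) atTop
      atTop := by
    refine tendsto_atTop_mono (fun k => ?_) (tendsto_atTop_add_const_right _ (-1) h1)
    have := norm_sub_le (1 + Complex.I * stieltjes I f (x + Complex.I * e k)) 1
    simp at this
    simp only [Function.comp]
    linarith
  have h3 : Tendsto (fun k => u k x) atTop atTop :=
    (Real.tendsto_log_atTop.comp h2).atTop_div_const (by positivity)
  exact hx.ne (ENNReal.tendsto_ofReal_atTop.comp h3).liminf_eq

end BoundaryGrowth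

/-! ### Almost everywhere Stieltjes–Perron inversion. -/

section PoissonKernel

theorem integral_Ioi_two_mul_div_one_add_sq_sq {a : ℝ} (ha : 0 ≤ a) :
    IntegrableOn (fun v : ℝ => 2 * v / (1 + v ^ 2) ^ 2) (Set.Ioi a) ∧
      ∫ v in Set.Ioi a, 2 * v / (1 + v ^ 2) ^ 2 = 1 / (1 + a ^ 2) := by
  have hd : ∀ v ∈ Set.Ici a,
      HasDerivAt (fun v : ℝ => -(1 + v ^ 2)⁻¹) (2 * v / (1 + v ^ 2) ^ 2) v := by
    intro v _
    have h0 : (1 + v ^ 2) ≠ 0 := by positivity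
    refine (((hasDerivAt_pow 2 v).const_add 1).inv h0).neg.congr_deriv ?_
    simp
    ring
  have hlim : Tendsto (fun v : ℝ => -(1 + v ^ 2)⁻¹) atTop (𝓝 0) := by
    have : Tendsto (fun v : ℝ => 1 + v ^ 2) atTop atTop :=
      tendsto_atTop_add_const_left _ _ (tendsto_pow_atTop two_ne_zero)
    simpa using this.inv_tendsto_atTop.neg
  have hpos : ∀ v ∈ Set.Ioi a, 0 ≤ 2 * v / (1 + v ^ 2) ^ 2 := fun v hv => by
    have : 0 ≤ v := ha.trans (le_of_lt hv)
    positivity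
  refine ⟨integrableOn_Ioi_deriv_of_nonneg' hd hpos hlim, ?_⟩
  rw [integral_Ioi_of_hasDerivAt_of_nonneg' hd hpos hlim]
  simp

theorem integral_Ioi_four_mul_sq_div_one_add_sq_sq :
    IntegrableOn (fun v : ℝ => 4 * v ^ 2 / (1 + v ^ 2) ^ 2) (Set.Ioi 0) ∧
      ∫ v in Set.Ioi (0 : ℝ), 4 * v ^ 2 / (1 + v ^ 2) ^ 2 = Real.pi := by
  have hd : ∀ v ∈ Set.Ici (0 : ℝ), HasDerivAt (fun v : ℝ => 2 * Real.arctan v - 2 * v / (1 + v ^ 2))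
      (4 * v ^ 2 / (1 + v ^ 2) ^ 2) v := by
    intro v _
    have h0 : (1 + v ^ 2) ≠ 0 := by positivity
    refine (((Real.hasDerivAt_arctan v).const_mul 2).sub
      (((hasDerivAt_id v).const_mul 2).div ((hasDerivAt_pow 2 v).const_add 1) h0)).congr_deriv ?_
    simp
    field_simp
    ring
  have hlim : Tendsto (fun v : ℝ => 2 * Real.arctan v - 2 * v / (1 + v ^ 2)) atTop
      (𝓝 Real.pi) := by
    have h1 : Tendsto (fun v : ℝ => 2 * Real.arctan v) atTop (𝓝 (2 * (Real.pi / 2))) :=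
      (Real.tendsto_arctan_atTop.mono_right nhdsWithin_le_nhds).const_mul 2
    have h2 : Tendsto (fun v : ℝ => 2 * v / (1 + v ^ 2)) atTop (𝓝 0) := by
      refine squeeze_zero' ?_ ?_ (tendsto_const_nhds (x := (2 : ℝ)).div_atTop tendsto_id)
      · filter_upwards [eventually_gt_atTop 0] with v hv
        positivity
      · filter_upwards [eventually_gt_atTop 0] with v hv
        simp only [id]
        rw [div_le_div_iff₀ (by positivity) hv]
        nlinarith
    have := h1.sub h2
    rwa [mul_div_cancel₀ _ two_ne_zero, sub_zero] at this
  have hpos : ∀ v ∈ Set.Ioi (0 : ℝ), 0 ≤ 4 * v ^ 2 / (1 + v ^ 2) ^ 2 := fun v _ => by positivity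
  refine ⟨integrableOn_Ioi_deriv_of_nonneg' hd hpos hlim, ?_⟩
  rw [integral_Ioi_of_hasDerivAt_of_nonneg' hd hpos hlim]
  simp

/-- The Poisson integral is a superposition of averages over symmetric intervals. -/
theorem integral_poisson_eq {f : ℝ → ℝ} (hf : Integrable f) (x : ℝ) {ε : ℝ} (hε : 0 < ε) :
    ∫ t, ε / ((x - t) ^ 2 + ε ^ 2) * f t =
      ∫ v in Set.Ioi (0 : ℝ), 4 * v ^ 2 / (1 + v ^ 2) ^ 2 *
        ((∫ t in (x - ε * v)..(x + ε * v), f t) / (2 * (ε * v))) := by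
  set S : Set (ℝ × ℝ) := {p | |p.2 - x| < ε * p.1} with hS
  have hSm : MeasurableSet S := measurableSet_lt (by fun_prop) (by fun_prop)
  -- The point t is within εv of x exactly when v > a = |t - x|/ε, and the weight in v has tail
  -- 1/(ε(1 + a²)) = ε/((x - t)² + ε²). Integrating H first in v gives the Poisson integrand, first
  -- in t the interval averages.
  set H : ℝ × ℝ → ℝ := S.indicator fun p => 2 * p.1 / (1 + p.1 ^ 2) ^ 2 / ε * f p.2 with hH
  have hint : Integrable H ((volume.restrict (Set.Ioi (0 : ℝ))).prod volume) :=
    (((integral_Ioi_two_mul_div_one_add_sq_sq le_rfl).1.div_const ε).mul_prod hf).indicator hSm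
  have hswap := integral_integral_swap (f := fun v t => H (v, t)) hint
  have hL : ∀ t, ∫ v in Set.Ioi (0 : ℝ), H (v, t) = ε / ((x - t) ^ 2 + ε ^ 2) * f t := by
    intro t
    have h1 : ∀ v, H (v, t) = (Set.Ioi (|t - x| / ε)).indicator
        (fun v => 2 * v / (1 + v ^ 2) ^ 2 * (f t / ε)) v := by
      intro v
      simp only [hH, hS, Set.indicator_apply, Set.mem_ofPred_eq, Set.mem_Ioi, div_lt_iff₀' hε]
      split_ifs
      · ring
      · rfl
    have h2 : 0 ≤ |t - x| / ε := by positivity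
    simp only [h1]
    rw [setIntegral_indicator measurableSet_Ioi, Set.Ioi_inter_Ioi, max_eq_right h2,
      integral_mul_const, (integral_Ioi_two_mul_div_one_add_sq_sq h2).2, div_pow, sq_abs]
    have h3 : (x - t) ^ 2 + ε ^ 2 ≠ 0 := by positivity
    have h4 : ε ^ 2 + (t - x) ^ 2 ≠ 0 := by positivity
    field_simp
    ring
  have hR : ∀ v ∈ Set.Ioi (0 : ℝ), ∫ t, H (v, t) = 4 * v ^ 2 / (1 + v ^ 2) ^ 2 *
        ((∫ t in (x - ε * v)..(x + ε * v), f t) / (2 * (ε * v))) := by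
    intro v hv
    have hv0 : 0 < v := hv
    have h1 : ∀ t, H (v, t) = (Set.Ioo (x - ε * v) (x + ε * v)).indicator
        (fun t => 2 * v / (1 + v ^ 2) ^ 2 / ε * f t) t := by
      intro t
      have : |t - x| < ε * v ↔ x - ε * v < t ∧ t < x + ε * v := by
        rw [abs_lt]
        constructor <;> rintro ⟨h, h'⟩ <;> constructor <;> linarith
      simp only [hH, hS, Set.indicator_apply, Set.mem_ofPred_eq, Set.mem_Ioo, this]
    simp only [h1]
    rw [integral_indicator measurableSet_Ioo, integral_const_mul, ← integral_Ioc_eq_integral_Ioo,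
      ← intervalIntegral.integral_of_le (by nlinarith)]
    field_simp
    ring
  rw [setIntegral_congr_fun measurableSet_Ioi hR] at hswap
  simp only [hL] at hswap
  exact hswap.symm

/-- The symmetric averages of f about x converge to f x and are bounded in the radius, so dominated
convergence applies to the superposition. The weight has total mass π. -/
theorem tendsto_integral_poisson {f : ℝ → ℝ} (hf : Integrable f) {x : ℝ}
    (hx : HasDerivAt (fun y => ∫ t in (0 : ℝ)..y, f t) (f x) x) :
    Tendsto (fun ε : ℝ => ∫ t, ε / ((x - t) ^ 2 + ε ^ 2) * f t) (𝓝[>] 0)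
      (𝓝 (Real.pi * f x)) := by
  set F : ℝ → ℝ := fun y => ∫ t in (0 : ℝ)..y, f t with hF
  set B : ℝ → ℝ := fun h => (∫ t in (x - h)..(x + h), f t) / (2 * h) with hB
  have hBF : ∀ h, B h = (F (x + h) - F (x - h)) / (2 * h) := fun h => by
    simp only [hB, hF]
    rw [intervalIntegral.integral_interval_sub_left hf.intervalIntegrable hf.intervalIntegrable]
  have hFc : Continuous F :=
    intervalIntegral.continuous_primitive (fun a b => hf.intervalIntegrable) 0
  have hBm : Measurable B := by
    have : B = fun h => (F (x + h) - F (x - h)) / (2 * h) := funext hBF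
    rw [this]
    have h1 : Measurable fun h => F (x + h) := (hFc.comp (by fun_prop)).measurable
    have h2 : Measurable fun h => F (x - h) := (hFc.comp (by fun_prop)).measurable
    exact (h1.sub h2).div (by fun_prop)
  have hBlim : Tendsto B (𝓝[>] 0) (𝓝 (f x)) := by
    have h1 : HasDerivAt (fun h => F (x + h) - F (x - h)) (f x + f x) 0 := by
      have e1 : HasDerivAt (fun h => F (x + h)) (f x) 0 :=
        HasDerivAt.comp_const_add x 0 (by simpa using hx)
      have e2 : HasDerivAt (fun h => F (x - h)) (-f x) 0 :=
        HasDerivAt.comp_const_sub x 0 (by simpa using hx)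
      have := e1.sub e2
      rw [sub_neg_eq_add] at this
      exact this
    have h2 := h1.tendsto_slope_zero_right.div_const 2
    rw [add_self_div_two] at h2
    refine h2.congr fun h => ?_
    rw [hBF]
    simp
    ring
  obtain ⟨M, hM⟩ : ∃ M, ∀ h, 0 < h → |B h| ≤ M := by
    have h1 : ∀ᶠ h in 𝓝[>] 0, |B h| < |f x| + 1 :=
      hBlim.abs.eventually (gt_mem_nhds (lt_add_one _))
    obtain ⟨δ, hδ, hδ'⟩ := (mem_nhdsGT_iff_exists_Ioo_subset).mp h1
    have hδ0 : 0 < δ := hδ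
    -- Radii below δ are controlled by convergence of the averages, larger ones by the L¹ norm of f.
    refine ⟨max (|f x| + 1) ((∫ t, |f t|) / (2 * δ)), fun h hh => ?_⟩
    by_cases hhδ : h < δ
    · exact le_max_of_le_left (le_of_lt (hδ' ⟨hh, hhδ⟩))
    · refine le_max_of_le_right ?_
      simp only [hB]
      rw [abs_div, abs_of_pos (show 0 < 2 * h by linarith),
        intervalIntegral.integral_of_le (by linarith)]
      push Not at hhδ
      have h2 : |∫ t in Set.Ioc (x - h) (x + h), f t| ≤ ∫ t, |f t| :=
        (abs_integral_le_integral_abs).trans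
          (setIntegral_le_integral hf.abs (ae_of_all _ fun t => abs_nonneg _))
      have h3 : 0 ≤ ∫ t, |f t| := integral_nonneg fun t => abs_nonneg _
      gcongr
  have hlim : Tendsto (fun ε : ℝ => ∫ v in Set.Ioi (0 : ℝ),
      4 * v ^ 2 / (1 + v ^ 2) ^ 2 * B (ε * v)) (𝓝[>] 0)
      (𝓝 (∫ v in Set.Ioi (0 : ℝ), 4 * v ^ 2 / (1 + v ^ 2) ^ 2 * f x)) := by
    refine tendsto_integral_filter_of_dominated_convergence
      (fun v => 4 * v ^ 2 / (1 + v ^ 2) ^ 2 * M) ?_ ?_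
      (integral_Ioi_four_mul_sq_div_one_add_sq_sq.1.mul_const M) ?_
    · refine Eventually.of_forall fun ε => Measurable.aestronglyMeasurable ?_
      exact Measurable.mul (by fun_prop) (hBm.comp (by fun_prop))
    · filter_upwards [self_mem_nhdsWithin] with ε hε
      refine (ae_restrict_iff' measurableSet_Ioi).mpr (ae_of_all _ fun v hv => ?_)
      rw [norm_mul, Real.norm_eq_abs, Real.norm_eq_abs,
        abs_of_nonneg (show 0 ≤ 4 * v ^ 2 / (1 + v ^ 2) ^ 2 by positivity)]
      gcongr
      exact hM _ (mul_pos hε hv)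
    · refine (ae_restrict_iff' measurableSet_Ioi).mpr (ae_of_all _ fun v hv => ?_)
      refine (hBlim.comp ?_).const_mul _
      refine tendsto_nhdsWithin_iff.mpr ⟨?_, ?_⟩
      · have : Tendsto (fun ε : ℝ => ε * v) (𝓝 0) (𝓝 (0 * v)) := tendsto_id.mul_const v
        rw [zero_mul] at this
        exact this.mono_left nhdsWithin_le_nhds
      · filter_upwards [self_mem_nhdsWithin] with ε hε
        exact mul_pos hε (Set.mem_Ioi.mp hv)
  rw [integral_mul_const, integral_Ioi_four_mul_sq_div_one_add_sq_sq.2] at hlim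
  refine hlim.congr' ?_
  filter_upwards [self_mem_nhdsWithin] with ε hε
  exact (integral_poisson_eq hf x hε).symm

theorem stieltjes_sub_stieltjes_eq_poisson {I : Set ℝ} {f : ℝ → ℝ} (hf : IntegrableOn f I)
    (x : ℝ) {ε : ℝ} (hε : 0 < ε) :
    stieltjes I f (x - Complex.I * ε) - stieltjes I f (x + Complex.I * ε) =
      2 * Complex.I * ((∫ t in I, ε / ((x - t) ^ 2 + ε ^ 2) * f t : ℝ) : ℂ) := by
  have h1 : ((x : ℂ) - Complex.I * ε).im ≠ 0 := by simpa using hε.ne'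
  have h2 : ((x : ℂ) + Complex.I * ε).im ≠ 0 := by simpa using hε.ne'
  unfold stieltjes
  rw [← integral_complex_ofReal, ← integral_const_mul,
    ← integral_sub (integrableOn_stieltjes_integrand hf h1)
      (integrableOn_stieltjes_integrand hf h2)]
  refine integral_congr_ae (ae_of_all _ fun t => ?_)
  have h3 := sub_ofReal_ne_zero h1 t
  have h4 := sub_ofReal_ne_zero h2 t
  have h5 : ((x : ℂ) - t) ^ 2 + ε ^ 2 = (x - Complex.I * ε - t) * (x + Complex.I * ε - t) := by
    linear_combination ((ε : ℂ) ^ 2) * Complex.I_sq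
  push_cast
  rw [h5]
  field_simp
  ring

/-- By Lebesgue differentiation the primitive of f, extended by zero off I, has derivative f x at
almost every x in I, and the Poisson integrals converge at such points. Inversion is thus available
for the secondary densities, for which it is not assumed. -/
theorem ae_stieltjesPerronLimit {I : Set ℝ} (hI : MeasurableSet I) {f : ℝ → ℝ}
    (hf : IntegrableOn f I) :
    ∀ᵐ x ∂(volume.restrict I), StieltjesPerronLimit I f x (f x) := by
  have hf' : Integrable (I.indicator f) := hf.integrable_indicator hI
  rw [ae_restrict_iff' hI]
  filter_upwards [LocallyIntegrable.ae_hasDerivAt_integral hf'.locallyIntegrable] with x hx hxI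
  have h1 := tendsto_integral_poisson hf' (hx 0)
  rw [Set.indicator_of_mem hxI] at h1
  have h2 := ((Complex.continuous_ofReal.tendsto _).comp h1).const_mul
    (1 / (2 * Complex.I * (Real.pi : ℂ)) * (2 * Complex.I))
  have hpi : (Real.pi : ℂ) ≠ 0 := by exact_mod_cast Real.pi_ne_zero
  have hlim : 1 / (2 * Complex.I * (Real.pi : ℂ)) * (2 * Complex.I) *
      ((Real.pi * f x : ℝ) : ℂ) = (f x : ℂ) := by
    push_cast
    have := Complex.I_ne_zero
    field_simp
  rw [hlim] at h2
  refine h2.congr' ?_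
  filter_upwards [self_mem_nhdsWithin] with ε hε
  rw [stieltjes_sub_stieltjes_eq_poisson hf x hε, mul_assoc, Function.comp, ← integral_indicator hI]
  congr 4
  funext t
  by_cases ht : t ∈ I <;> simp [ht]

end PoissonKernel

/-! ### Transforms of polynomial multiples of the density. -/

section Moments

variable {I : Set ℝ} {ρ : ℝ → ℝ}

theorem integrableOn_eval_mul (hmom : ∀ k : ℕ, IntegrableOn (fun x => x ^ k * ρ x) I) (p : ℝ[X]) :
    IntegrableOn (fun x => p.eval x * ρ x) I := by
  induction p using Polynomial.induction_on' with
  | add p q hp hq =>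
    simp only [eval_add, add_mul]
    exact hp.add hq
  | monomial n a =>
    simp only [eval_monomial, mul_assoc]
    exact (hmom n).const_mul a

/-- Integration against a density with finite moments, as a functional on polynomials. -/
noncomputable def momentFunctional (hmom : ∀ k : ℕ, IntegrableOn (fun x => x ^ k * ρ x) I) :
    ℝ[X] →ₗ[ℝ] ℝ where
  toFun p := ∫ x in I, p.eval x * ρ x
  map_add' p q := by
    simp only [eval_add, add_mul]
    exact integral_add (integrableOn_eval_mul hmom p) (integrableOn_eval_mul hmom q)
  map_smul' c p := by
    simp only [eval_smul, smul_eq_mul, mul_assoc, integral_const_mul, RingHom.id_apply]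

theorem momentFunctional_apply (hmom : ∀ k : ℕ, IntegrableOn (fun x => x ^ k * ρ x) I)
    (p : ℝ[X]) : momentFunctional hmom p = ∫ x in I, p.eval x * ρ x := rfl

/-- The Stieltjes transform of `p ρ` is `p S_ρ - q`, with `q` the secondary polynomial of `p`. -/
theorem exists_secondaryPolynomial_eq
    (hmom : ∀ k : ℕ, IntegrableOn (fun x => x ^ k * ρ x) I) (p : ℝ[X]) :
    ∃ q : ℝ[X],
      (∀ x, IntegrableOn (fun t => (p.eval t - p.eval x) / (t - x) * ρ t) I ∧
        secondaryPolynomial I ρ p x = q.eval x) ∧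
      ∀ z : ℂ, z.im ≠ 0 → stieltjes I (fun t => p.eval t * ρ t) z =
        aeval z p * stieltjes I ρ z - aeval z q := by
  induction p using Polynomial.induction_on with
  | C a =>
    refine ⟨0, fun x => ⟨by simp, by simp [secondaryPolynomial]⟩,
      fun z hz => ?_⟩
    simpa using stieltjes_const_mul (I := I) (f := ρ) (z := z) a
  | add p₁ p₂ h₁ h₂ =>
    obtain ⟨q₁, hq₁, hz₁⟩ := h₁
    obtain ⟨q₂, hq₂, hz₂⟩ := h₂
    have hsplit : ∀ x t : ℝ, ((p₁ + p₂).eval t - (p₁ + p₂).eval x) / (t - x) * ρ t =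
        (p₁.eval t - p₁.eval x) / (t - x) * ρ t + (p₂.eval t - p₂.eval x) / (t - x) * ρ t := by
      intro x t
      rw [eval_add, eval_add]
      ring
    refine ⟨q₁ + q₂, fun x => ⟨?_, ?_⟩, fun z hz => ?_⟩
    · simp only [hsplit]
      exact (hq₁ x).1.add (hq₂ x).1
    · rw [eval_add, ← (hq₁ x).2, ← (hq₂ x).2]
      unfold secondaryPolynomial
      simp only [hsplit]
      exact integral_add (hq₁ x).1 (hq₂ x).1
    · simp only [eval_add, add_mul, map_add]
      rw [stieltjes_add (integrableOn_eval_mul hmom p₁) (integrableOn_eval_mul hmom p₂) hz,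
        hz₁ z hz, hz₂ z hz]
      ring
  | monomial n a h =>
    obtain ⟨q, hq, hqz⟩ := h
    set p : ℝ[X] := C a * X ^ n with hp
    have hpX : C a * X ^ (n + 1) = X * p := by rw [hp]; ring
    rw [hpX]
    -- From t p(t) - x p(x) = (t - x) p(t) + x (p(t) - p(x)); so the secondary polynomial of X p is
    -- ∫ p ρ + X q. The identity may fail at t = x, a null set.
    have hsplit : ∀ x : ℝ, (fun t => ((X * p).eval t - (X * p).eval x) / (t - x) * ρ t)
        =ᵐ[volume.restrict I] fun t =>
          p.eval t * ρ t + x * ((p.eval t - p.eval x) / (t - x) * ρ t) := by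
      intro x
      have : ∀ᵐ t ∂(volume.restrict I), t ≠ x := ae_restrict_of_ae (by simp [ae_iff])
      filter_upwards [this] with t ht
      have := sub_ne_zero.mpr ht
      simp only [eval_mul, eval_X]
      field_simp
      ring
    refine ⟨C (∫ t in I, p.eval t * ρ t) + X * q, fun x => ⟨?_, ?_⟩, fun z hz => ?_⟩
    · exact ((integrableOn_eval_mul hmom p).add ((hq x).1.const_mul x)).congr (hsplit x).symm
    · unfold secondaryPolynomial
      rw [integral_congr_ae (hsplit x),
        integral_add (integrableOn_eval_mul hmom p) ((hq x).1.const_mul x), integral_const_mul]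
      have := (hq x).2
      unfold secondaryPolynomial at this
      rw [this]
      simp
    · have h1 : (fun t => (X * p).eval t * ρ t) = fun t => t * (p.eval t * ρ t) := by
        funext t
        simp [mul_assoc]
      have h2 : IntegrableOn (fun t => t * (p.eval t * ρ t)) I := by
        rw [← h1]
        exact integrableOn_eval_mul hmom _
      have h3 := mul_stieltjes (integrableOn_eval_mul hmom p) h2 hz
      rw [h1, ← sub_eq_iff_eq_add.mpr h3, hqz z hz]
      simp only [map_mul, map_add, aeval_X, aeval_C]
      simp only [Complex.coe_algebraMap]
      ring

/-- Moving one more factor z inside the integral costs the moment of X^j p, which vanishes for j <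
n. Orthogonality thus becomes decay of order z^{-(n+1)}. -/
theorem pow_mul_stieltjes_eval_mul (hmom : ∀ k : ℕ, IntegrableOn (fun x => x ^ k * ρ x) I)
    (p : ℝ[X]) (n : ℕ) (h0 : ∀ j < n, momentFunctional hmom (X ^ j * p) = 0) {z : ℂ}
    (hz : z.im ≠ 0) :
    z ^ n * stieltjes I (fun t => p.eval t * ρ t) z =
      stieltjes I (fun t => (X ^ n * p).eval t * ρ t) z := by
  induction n with
  | zero => simp
  | succ n ih =>
    have h1 : (fun t => (X ^ (n + 1) * p).eval t * ρ t) =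
        fun t => t * ((X ^ n * p).eval t * ρ t) := by
      funext t
      simp only [eval_mul, eval_pow, eval_X]
      ring
    have h2 : IntegrableOn (fun t => t * ((X ^ n * p).eval t * ρ t)) I := by
      rw [← h1]
      exact integrableOn_eval_mul hmom _
    have h3 := mul_stieltjes (integrableOn_eval_mul hmom (X ^ n * p)) h2 hz
    rw [← momentFunctional_apply hmom, h0 n (Nat.lt_succ_self n), Complex.ofReal_zero,
      add_zero] at h3
    rw [h1, ← h3, ← ih fun j hj => h0 j (by omega)]
    ring

theorem tendsto_pow_succ_mul_stieltjes_eval_mul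
    (hmom : ∀ k : ℕ, IntegrableOn (fun x => x ^ k * ρ x) I)
    (p : ℝ[X]) (n : ℕ) (h0 : ∀ j < n, momentFunctional hmom (X ^ j * p) = 0) :
    Tendsto (fun y : ℝ => (Complex.I * y) ^ (n + 1) *
        stieltjes I (fun t => p.eval t * ρ t) (Complex.I * y)) atTop
      (𝓝 (momentFunctional hmom (X ^ n * p) : ℂ)) := by
  refine (tendsto_mul_stieltjes_atTop (integrableOn_eval_mul hmom (X ^ n * p))).congr' ?_
  filter_upwards [eventually_gt_atTop 0] with y hy
  rw [← pow_mul_stieltjes_eval_mul hmom p n h0 (by simpa using hy.ne')]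
  ring

end Moments

/-! ### Functions of the second kind and transforms of the secondary densities. -/

section SecondaryDensities

variable {I : Set ℝ} {ρ φ : ℝ → ℝ} {P : ℕ → ℝ[X]}

/-- The function of the second kind `∫_I P_n(t) ρ(t) / (z - t) dt`. -/
noncomputable def secondKind (I : Set ℝ) (ρ : ℝ → ℝ) (P : ℕ → ℝ[X]) (n : ℕ) (z : ℂ) : ℂ :=
  stieltjes I (fun t => (P n).eval t * ρ t) z

/-- The sequence `P_0, t_0 R_0, t_1 R_1, …`, with `R_n` the functions of the second kind. -/
noncomputable def secondKindPred (I : Set ℝ) (ρ : ℝ → ℝ) (P : ℕ → ℝ[X]) : ℕ → ℂ → ℂ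
  | 0, _ => ((P 0).coeff 0 : ℂ)
  | n + 1, z => offDiagonalCoeff I ρ P n * secondKind I ρ P n z

theorem offDiagonalCoeff_eq (hmom : ∀ k : ℕ, IntegrableOn (fun x => x ^ k * ρ x) I) (n : ℕ) :
    offDiagonalCoeff I ρ P n = momentFunctional hmom (X * P n * P (n + 1)) := by
  simp [offDiagonalCoeff, momentFunctional_apply]

theorem diagonalCoeff_eq (hmom : ∀ k : ℕ, IntegrableOn (fun x => x ^ k * ρ x) I) (n : ℕ) :
    diagonalCoeff I ρ P n = momentFunctional hmom (X * P n * P n) := by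
  simp [diagonalCoeff, momentFunctional_apply]

theorem IsOrthonormalPolynomials.momentFunctional_mul (hP : IsOrthonormalPolynomials I ρ P)
    (hmom : ∀ k : ℕ, IntegrableOn (fun x => x ^ k * ρ x) I) (m n : ℕ) :
    momentFunctional hmom (P m * P n) = if m = n then 1 else 0 := by
  rw [← hP.orthonormal m n, momentFunctional_apply]
  simp

theorem offDiagonalCoeff_ne_zero (hP : IsOrthonormalPolynomials I ρ P)
    (hmom : ∀ k : ℕ, IntegrableOn (fun x => x ^ k * ρ x) I) (n : ℕ) :
    offDiagonalCoeff I ρ P n ≠ 0 := by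
  rw [offDiagonalCoeff_eq hmom]
  exact apply_X_mul_orthonormal_ne_zero hP.natDegree_eq (hP.momentFunctional_mul hmom) n

theorem three_term_recurrence_zero (hP : IsOrthonormalPolynomials I ρ P)
    (hmom : ∀ k : ℕ, IntegrableOn (fun x => x ^ k * ρ x) I) :
    X * P 0 = C (offDiagonalCoeff I ρ P 0) * P 1 + C (diagonalCoeff I ρ P 0) * P 0 := by
  rw [offDiagonalCoeff_eq hmom, diagonalCoeff_eq hmom]
  exact X_mul_orthonormal_zero hP.natDegree_eq (hP.momentFunctional_mul hmom)

theorem three_term_recurrence_succ (hP : IsOrthonormalPolynomials I ρ P)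
    (hmom : ∀ k : ℕ, IntegrableOn (fun x => x ^ k * ρ x) I) (k : ℕ) :
    X * P (k + 1) = C (offDiagonalCoeff I ρ P (k + 1)) * P (k + 2) +
      C (diagonalCoeff I ρ P (k + 1)) * P (k + 1) + C (offDiagonalCoeff I ρ P k) * P k := by
  rw [offDiagonalCoeff_eq hmom, offDiagonalCoeff_eq hmom, diagonalCoeff_eq hmom]
  exact X_mul_orthonormal_succ hP.natDegree_eq (hP.momentFunctional_mul hmom) k

theorem eq_C_coeff_zero (hP : IsOrthonormalPolynomials I ρ P) : P 0 = C ((P 0).coeff 0) :=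
  eq_C_of_natDegree_eq_zero (hP.natDegree_eq 0)

theorem coeff_zero_mul_self (hρ : IsProbabilityDensityOn I ρ)
    (hP : IsOrthonormalPolynomials I ρ P) : (P 0).coeff 0 * (P 0).coeff 0 = 1 := by
  have h := hP.orthonormal 0 0
  rw [eq_C_coeff_zero hP] at h
  simp only [eval_C, if_true, integral_const_mul, hρ.integral_eq_one, mul_one] at h
  exact h

/-- Multiplying by z produces the transform of X P_n plus ∫ P_n ρ. This integral is zero for n ≥ 1;
for n = 0 it is the constant P_0, which plays the part of the missing t_{-1} R_{-1}. -/
theorem mul_secondKind (hρ : IsProbabilityDensityOn I ρ)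
    (hmom : ∀ k : ℕ, IntegrableOn (fun x => x ^ k * ρ x) I)
    (hP : IsOrthonormalPolynomials I ρ P) (n : ℕ) {z : ℂ} (hz : z.im ≠ 0) :
    z * secondKind I ρ P n z = offDiagonalCoeff I ρ P n * secondKind I ρ P (n + 1) z +
      diagonalCoeff I ρ P n * secondKind I ρ P n z + secondKindPred I ρ P n z := by
  have hi := fun p : ℝ[X] => integrableOn_eval_mul hmom p
  have hX : (fun t => t * ((P n).eval t * ρ t)) = fun t => (X * P n).eval t * ρ t := by
    funext t
    simp [mul_assoc]
  have h1 : IntegrableOn (fun t => t * ((P n).eval t * ρ t)) I := hX ▸ hi (X * P n)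
  have h2 := mul_stieltjes (hi (P n)) h1 hz
  have hsum : ∀ (a b : ℝ) (p q : ℝ[X]), stieltjes I (fun t => (C a * p + C b * q).eval t * ρ t) z =
      a * stieltjes I (fun t => p.eval t * ρ t) z +
        b * stieltjes I (fun t => q.eval t * ρ t) z := by
    intro a b p q
    rw [← stieltjes_const_mul, ← stieltjes_const_mul,
      ← stieltjes_add ((hi p).const_mul a) ((hi q).const_mul b) hz]
    simp [add_mul, mul_assoc]
  rw [hX] at h2
  unfold secondKind
  rw [h2]
  cases n with
  | zero =>
    rw [three_term_recurrence_zero hP hmom, hsum]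
    have : ∫ t in I, (P 0).eval t * ρ t = (P 0).coeff 0 := by
      conv_lhs => rw [eq_C_coeff_zero hP]
      simp [integral_const_mul, hρ.integral_eq_one]
    rw [this, secondKindPred]
  | succ n =>
    have h3 : C (offDiagonalCoeff I ρ P (n + 1)) * P (n + 2) +
        C (diagonalCoeff I ρ P (n + 1)) * P (n + 1) + C (offDiagonalCoeff I ρ P n) * P n =
        C 1 * (C (offDiagonalCoeff I ρ P (n + 1)) * P (n + 2) +
          C (diagonalCoeff I ρ P (n + 1)) * P (n + 1)) + C (offDiagonalCoeff I ρ P n) * P n := by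
      simp
    have h4 : ∫ t in I, (P (n + 1)).eval t * ρ t = 0 := by
      rw [← momentFunctional_apply hmom, ← one_mul (P (n + 1)), ← pow_zero X]
      exact apply_X_pow_mul_orthonormal_of_lt hP.natDegree_eq (hP.momentFunctional_mul hmom)
        (Nat.succ_pos n)
    rw [three_term_recurrence_succ hP hmom, h3, hsum, hsum, h4, secondKindPred, secondKind]
    simp

/-- The Casorati determinant of the two solutions of the three-term recurrence. -/
theorem casorati_secondKind (hρ : IsProbabilityDensityOn I ρ)
    (hmom : ∀ k : ℕ, IntegrableOn (fun x => x ^ k * ρ x) I)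
    (hP : IsOrthonormalPolynomials I ρ P) (n : ℕ) {z : ℂ} (hz : z.im ≠ 0) :
    offDiagonalCoeff I ρ P n * (aeval z (P n) * secondKind I ρ P (n + 1) z -
      aeval z (P (n + 1)) * secondKind I ρ P n z) = -1 := by
  induction n with
  | zero =>
    have h1 := mul_secondKind hρ hmom hP 0 hz
    have h2 := congrArg (aeval z) (three_term_recurrence_zero hP hmom)
    have h3 : ((P 0).coeff 0 : ℂ) * (P 0).coeff 0 = 1 := by
      exact_mod_cast coeff_zero_mul_self hρ hP
    have h4 : aeval z (P 0) = ((P 0).coeff 0 : ℂ) := by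
      conv_lhs => rw [eq_C_coeff_zero hP]
      simp
    simp only [map_mul, map_add, aeval_X, aeval_C, Complex.coe_algebraMap] at h2
    rw [secondKindPred] at h1
    linear_combination (-aeval z (P 0)) * h1 + (secondKind I ρ P 0 z) * h2 - h3 +
      (-((P 0).coeff 0 : ℂ)) * h4
  | succ n ih =>
    have h1 := mul_secondKind hρ hmom hP (n + 1) hz
    have h2 := congrArg (aeval z) (three_term_recurrence_succ hP hmom n)
    simp only [map_mul, map_add, aeval_X, aeval_C, Complex.coe_algebraMap] at h2
    rw [secondKindPred] at h1
    -- Cross-multiplying the two recurrences cancels the z and s terms, leaving the determinant one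
    -- index lower.
    linear_combination (-aeval z (P (n + 1))) * h1 + (secondKind I ρ P (n + 1) z) * h2 + ih

theorem tendsto_secondKind (hmom : ∀ k : ℕ, IntegrableOn (fun x => x ^ k * ρ x) I)
    (hP : IsOrthonormalPolynomials I ρ P) (n : ℕ) :
    Tendsto (fun y : ℝ => (Complex.I * y) ^ (n + 1) * secondKind I ρ P n (Complex.I * y)) atTop
      (𝓝 ((1 / (P n).coeff n : ℝ) : ℂ)) := by
  rw [← apply_X_pow_mul_orthonormal hP.natDegree_eq (hP.momentFunctional_mul hmom) n]
  exact tendsto_pow_succ_mul_stieltjes_eval_mul hmom (P n) n fun j hj =>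
    apply_X_pow_mul_orthonormal_of_lt hP.natDegree_eq (hP.momentFunctional_mul hmom) hj

theorem tendsto_mul_secondKind_div (hmom : ∀ k : ℕ, IntegrableOn (fun x => x ^ k * ρ x) I)
    (hP : IsOrthonormalPolynomials I ρ P) (n : ℕ) :
    Tendsto (fun y : ℝ => (Complex.I * y) * (secondKind I ρ P (n + 1) (Complex.I * y) /
      secondKind I ρ P n (Complex.I * y))) atTop (𝓝 (offDiagonalCoeff I ρ P n : ℂ)) := by
  have hc := coeff_self_ne_zero_of_orthonormal hP.natDegree_eq (hP.momentFunctional_mul hmom)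
  have h0 : ((1 / (P n).coeff n : ℝ) : ℂ) ≠ 0 := by
    exact_mod_cast one_div_ne_zero (hc n)
  have h := (tendsto_secondKind hmom hP (n + 1)).div (tendsto_secondKind hmom hP n) h0
  have hlim : ((1 / (P (n + 1)).coeff (n + 1) : ℝ) : ℂ) / ((1 / (P n).coeff n : ℝ) : ℂ) =
      (offDiagonalCoeff I ρ P n : ℂ) := by
    rw [← Complex.ofReal_div, offDiagonalCoeff_eq hmom, coeff_self_eq_mul hP.natDegree_eq
      (hP.momentFunctional_mul hmom) n]
    congr 1
    have := hc (n + 1)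
    field_simp
  rw [hlim] at h
  refine h.congr' ?_
  filter_upwards [eventually_gt_atTop 0] with y hy
  have : Complex.I * (y : ℂ) ≠ 0 := mul_ne_zero Complex.I_ne_zero (by exact_mod_cast hy.ne')
  simp only [Pi.div_apply]
  rw [pow_succ _ (n + 1), mul_assoc, mul_div_mul_comm, div_self (pow_ne_zero _ this), one_mul,
    mul_div_assoc]

/-- The Stieltjes transform of an `n`-th secondary density is the quotient of two consecutive
functions of the second kind, up to a constant. -/
theorem stieltjes_nthSecondaryDensity (hI : MeasurableSet I) (hρ : IsProbabilityDensityOn I ρ)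
    (hmom : ∀ k : ℕ, IntegrableOn (fun x => x ^ k * ρ x) I)
    (hP : IsOrthonormalPolynomials I ρ P) (n : ℕ) :
    ∀ σ : ℝ → ℝ, IsNthSecondaryDensity I ρ n σ → IsProbabilityDensityOn I σ ∧
      ∀ z : ℂ, z.im ≠ 0 → stieltjes I σ z = secondKind I ρ P n z / secondKindPred I ρ P n z := by
  induction n with
  | zero =>
    rintro σ rfl
    refine ⟨hρ, fun z hz => ?_⟩
    have h0 : ((P 0).coeff 0 : ℂ) ≠ 0 := by
      exact_mod_cast left_ne_zero_of_mul_eq_one (coeff_zero_mul_self hρ hP)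
    have h1 : secondKind I σ P 0 z = (P 0).coeff 0 * stieltjes I σ z := by
      rw [secondKind, ← stieltjes_const_mul]
      congr 1
      funext t
      conv_lhs => rw [eq_C_coeff_zero hP]
      simp
    rw [h1, secondKindPred, mul_div_cancel_left₀ _ h0]
  | succ n ih =>
    rintro σ ⟨τ, hτ, hσ⟩
    obtain ⟨hτ1, hτ2⟩ := ih τ hτ
    have hσ1 := hσ.isProbabilityDensityOn
    refine ⟨hσ1, ?_⟩
    have hne : ∀ z : ℂ, z.im ≠ 0 → secondKind I ρ P n z ≠ 0 := fun z hz => by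
      have := stieltjes_ne_zero hτ1 hI hz
      rw [hτ2 z hz] at this
      exact (div_ne_zero_iff.mp this).1
    set t : ℂ := (offDiagonalCoeff I ρ P n : ℂ) with ht
    set s : ℂ := (diagonalCoeff I ρ P n : ℂ) with hs
    set d : ℂ := (densityVariance I τ : ℂ) with hd
    set c : ℂ := (densityMoment I τ 1 : ℂ) with hc
    have ht0 : t ≠ 0 := Complex.ofReal_ne_zero.mpr (offDiagonalCoeff_ne_zero hP hmom n)
    -- The recurrence for R_n divided by R_n: 1/S_τ is the predecessor term over R_n.
    have hsinv : ∀ z : ℂ, z.im ≠ 0 → z - 1 / stieltjes I τ z =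
        s + t * (secondKind I ρ P (n + 1) z / secondKind I ρ P n z) := by
      intro z hz
      have h1 := mul_secondKind hρ hmom hP n hz
      have h2 := hne z hz
      rw [hτ2 z hz, one_div_div]
      field_simp
      linear_combination h1
    -- With zero variance the convention 1/0 = 0 would give S_σ(i) = 0, impossible for a probability
    -- density.
    have hd0 : d ≠ 0 := by
      intro h0
      have h1 := hσ.stieltjes_eq Complex.I (by simp)
      rw [← hd, h0] at h1
      exact stieltjes_ne_zero hσ1 hI (z := Complex.I) (by simp) (by simpa using h1)
    have hS : ∀ z : ℂ, z.im ≠ 0 → d * stieltjes I σ z =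
        s - c + t * (secondKind I ρ P (n + 1) z / secondKind I ρ P n z) := by
      intro z hz
      have h1 := hσ.stieltjes_eq z hz
      rw [← hd, ← hc] at h1
      rw [h1]
      have h2 := hsinv z hz
      field_simp at h2 ⊢
      linear_combination h2
    have him : ∀ y : ℝ, 0 < y → (Complex.I * (y : ℂ)).im ≠ 0 := fun y hy => by
      simpa using hy.ne'
    have hlim1 := tendsto_mul_stieltjes_atTop hσ1.integrableOn
    rw [hσ1.integral_eq_one, Complex.ofReal_one] at hlim1
    have hlim2 := tendsto_mul_secondKind_div hmom hP n
    -- Both c and d are read off at infinity, from z S_σ → 1 and z R_{n+1}/R_n → t, rather than by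
    -- computing moments of τ. A finite limit here forces s = c, and then d = t².
    have hlim3 : Tendsto (fun y : ℝ => (Complex.I * (y : ℂ)) * (s - c)) atTop
        (𝓝 (d * 1 - t * t)) := by
      refine ((hlim1.const_mul d).sub (hlim2.const_mul t)).congr' ?_
      filter_upwards [eventually_gt_atTop 0] with y hy
      linear_combination (Complex.I * (y : ℂ)) * hS _ (him y hy)
    have hinv : Tendsto (fun y : ℝ => (Complex.I * (y : ℂ))⁻¹) atTop (𝓝 0) := by
      have h1 := ((Complex.continuous_ofReal.tendsto 0).comp
        tendsto_inv_atTop_zero).const_mul Complex.I⁻¹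
      rw [Complex.ofReal_zero, mul_zero] at h1
      refine h1.congr fun y => ?_
      simp [mul_comm]
    have hcs : s - c = 0 := by
      have h1 := hinv.mul hlim3
      rw [zero_mul] at h1
      refine tendsto_nhds_unique (tendsto_const_nhds.congr' ?_) h1
      filter_upwards [eventually_gt_atTop 0] with y hy
      have : (y : ℂ) ≠ 0 := by exact_mod_cast hy.ne'
      have := Complex.I_ne_zero
      field_simp
    have hdt : d = t * t := by
      rw [hcs] at hlim3
      simp only [mul_zero, mul_one] at hlim3
      have := tendsto_nhds_unique hlim3 tendsto_const_nhds
      linear_combination this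
    intro z hz
    have h1 := hS z hz
    rw [hcs, zero_add, hdt, mul_assoc] at h1
    have h2 := mul_left_cancel₀ ht0 h1
    rw [secondKindPred, ← ht, div_mul_eq_div_div_swap, ← h2, mul_div_cancel_left₀ _ ht0]

end SecondaryDensities

/-! ### Boundary values on the real axis and the explicit formula. -/

section BoundaryValues

variable {I : Set ℝ} {ρ φ : ℝ → ℝ} {P : ℕ → ℝ[X]} {x : ℝ}

theorem tendsto_ofReal_sub_I_mul (x : ℝ) :
    Tendsto (fun ε : ℝ => (x : ℂ) - Complex.I * ε) (𝓝[>] 0) (𝓝 x) := by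
  have : Tendsto (fun ε : ℝ => (x : ℂ) - Complex.I * ε) (𝓝 0) (𝓝 (x - Complex.I * (0 : ℝ))) :=
    Continuous.tendsto (by fun_prop) 0
  simp only [Complex.ofReal_zero, mul_zero, sub_zero] at this
  exact this.mono_left nhdsWithin_le_nhds

theorem tendsto_ofReal_add_I_mul (x : ℝ) :
    Tendsto (fun ε : ℝ => (x : ℂ) + Complex.I * ε) (𝓝[>] 0) (𝓝 x) := by
  have : Tendsto (fun ε : ℝ => (x : ℂ) + Complex.I * ε) (𝓝 0) (𝓝 (x + Complex.I * (0 : ℝ))) :=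
    Continuous.tendsto (by fun_prop) 0
  simp only [Complex.ofReal_zero, mul_zero, add_zero] at this
  exact this.mono_left nhdsWithin_le_nhds

theorem eventually_im_sub_I_mul_ne_zero (x : ℝ) :
    ∀ᶠ ε : ℝ in 𝓝[>] 0, ((x : ℂ) - Complex.I * ε).im ≠ 0 := by
  filter_upwards [self_mem_nhdsWithin] with ε hε
  simpa using (ne_of_gt hε)

theorem eventually_im_add_I_mul_ne_zero (x : ℝ) :
    ∀ᶠ ε : ℝ in 𝓝[>] 0, ((x : ℂ) + Complex.I * ε).im ≠ 0 := by
  filter_upwards [self_mem_nhdsWithin] with ε hε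
  simpa using (ne_of_gt hε)

theorem tendsto_stieltjes_boundary {r f : ℝ} (hr : StieltjesPerronLimit I ρ x r)
    (hf : Tendsto (fun ε : ℝ => stieltjes I ρ ((x : ℂ) - Complex.I * (ε : ℂ)) +
      stieltjes I ρ ((x : ℂ) + Complex.I * (ε : ℂ))) (𝓝[>] 0) (𝓝 (f : ℂ))) :
    Tendsto (fun ε : ℝ => stieltjes I ρ ((x : ℂ) - Complex.I * ε)) (𝓝[>] 0)
        (𝓝 ((f : ℂ) / 2 + Complex.I * Real.pi * r)) ∧
      Tendsto (fun ε : ℝ => stieltjes I ρ ((x : ℂ) + Complex.I * ε)) (𝓝[>] 0)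
        (𝓝 ((f : ℂ) / 2 - Complex.I * Real.pi * r)) := by
  have hpi : (Real.pi : ℂ) ≠ 0 := Complex.ofReal_ne_zero.mpr Real.pi_ne_zero
  have hI := Complex.I_ne_zero
  have h1 := Tendsto.const_mul (Complex.I * Real.pi) hr
  have h2 := hf.div_const 2
  constructor
  · refine (h2.add h1).congr fun ε => ?_
    field_simp
    ring
  · refine (h2.sub h1).congr fun ε => ?_
    field_simp
    ring

theorem tendsto_secondKind_boundary
    (hmom : ∀ k : ℕ, IntegrableOn (fun x => x ^ k * ρ x) I) (n : ℕ) {ι : Type*} {l : Filter ι}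
    {w : ι → ℂ} {s : ℂ} (hw : Tendsto w l (𝓝 x)) (hw0 : ∀ᶠ i in l, (w i).im ≠ 0)
    (hs : Tendsto (fun i => stieltjes I ρ (w i)) l (𝓝 s)) :
    Tendsto (fun i => secondKind I ρ P n (w i)) l
      (𝓝 ((P n).eval x * s - secondaryPolynomial I ρ (P n) x)) := by
  obtain ⟨q, hq, hqz⟩ := exists_secondaryPolynomial_eq hmom (P n)
  have hpoly : ∀ p : ℝ[X], Tendsto (fun i => aeval (w i) p) l (𝓝 ((p.eval x : ℝ) : ℂ)) := by
    intro p
    have h1 := (p.continuous_aeval.tendsto (x : ℂ)).comp hw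
    have h2 : aeval (x : ℂ) p = ((p.eval x : ℝ) : ℂ) := by
      have := aeval_algebraMap_apply ℂ x p
      simpa using this
    rwa [h2] at h1
  rw [(hq x).2]
  refine (((hpoly (P n)).mul hs).sub (hpoly q)).congr' ?_
  filter_upwards [hw0] with i hi
  exact (hqz _ hi).symm

/-- Let z → x in the Casorati identity for R_n = P_n S_ρ - Q_n: the boundary value s enters both
products as P_n P_{n+1} s and cancels. -/
theorem casorati_secondaryPolynomial (hρ : IsProbabilityDensityOn I ρ)
    (hmom : ∀ k : ℕ, IntegrableOn (fun x => x ^ k * ρ x) I)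
    (hP : IsOrthonormalPolynomials I ρ P) (n : ℕ) {s : ℂ}
    (hs : Tendsto (fun ε : ℝ => stieltjes I ρ ((x : ℂ) + Complex.I * ε)) (𝓝[>] 0) (𝓝 s)) :
    (offDiagonalCoeff I ρ P n : ℂ) *
      ((P n).eval x * secondaryPolynomial I ρ (P (n + 1)) x -
        (P (n + 1)).eval x * secondaryPolynomial I ρ (P n) x) = 1 := by
  have h := fun m => tendsto_secondKind_boundary (P := P) hmom m (tendsto_ofReal_add_I_mul x)
    (eventually_im_add_I_mul_ne_zero x) hs
  obtain ⟨hp, hp'⟩ : Tendsto (fun ε : ℝ => aeval ((x : ℂ) + Complex.I * ε) (P n)) (𝓝[>] 0)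
        (𝓝 (aeval (x : ℂ) (P n))) ∧
      Tendsto (fun ε : ℝ => aeval ((x : ℂ) + Complex.I * ε) (P (n + 1))) (𝓝[>] 0)
        (𝓝 (aeval (x : ℂ) (P (n + 1)))) :=
    ⟨((P n).continuous_aeval.tendsto _).comp (tendsto_ofReal_add_I_mul x),
      ((P (n + 1)).continuous_aeval.tendsto _).comp (tendsto_ofReal_add_I_mul x)⟩
  have heval : ∀ p : ℝ[X], aeval (x : ℂ) p = ((p.eval x : ℝ) : ℂ) := fun p => by
    simpa using aeval_algebraMap_apply ℂ x p
  rw [heval] at hp hp'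
  have h1 := ((hp.mul (h (n + 1))).sub (hp'.mul (h n))).const_mul (offDiagonalCoeff I ρ P n : ℂ)
  have h2 := tendsto_nhds_unique (h1.congr' ?_) (tendsto_const_nhds (x := (-1 : ℂ)))
  · linear_combination -h2
  · filter_upwards [eventually_im_add_I_mul_ne_zero x] with ε hε
    exact casorati_secondKind hρ hmom hP n hε

/-- The two factors are the complex conjugate boundary values of R_n from below and from above. -/
theorem ofReal_secondaryDenominator (n : ℕ) :
    (secondaryDenominator I ρ φ P n x : ℂ) =
      ((P n).eval x * ((φ x : ℂ) / 2 + Complex.I * Real.pi * ρ x) -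
          secondaryPolynomial I ρ (P n) x) *
        ((P n).eval x * ((φ x : ℂ) / 2 - Complex.I * Real.pi * ρ x) -
          secondaryPolynomial I ρ (P n) x) := by
  unfold secondaryDenominator
  push_cast
  linear_combination ((Real.pi : ℂ) ^ 2 * ρ x ^ 2 * (P n).eval x ^ 2) * Complex.I_sq

/-- Since D ≠ 0, both boundary values of R_n are nonzero and R_{n+1}/(t_n R_n) has one-sided limits;
their difference over a common denominator gives the formula. -/
theorem stieltjesPerronLimit_nthSecondaryDensity (hI : MeasurableSet I)
    (hρ : IsProbabilityDensityOn I ρ)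
    (hmom : ∀ k : ℕ, IntegrableOn (fun x => x ^ k * ρ x) I)
    (hP : IsOrthonormalPolynomials I ρ P) (hinv : SatisfiesInversion I ρ)
    (hφ : IsReducer I ρ φ) {n : ℕ} {σ : ℝ → ℝ} (hσ : IsNthSecondaryDensity I ρ (n + 1) σ)
    (hx : x ∈ I) (hD : secondaryDenominator I ρ φ P n x ≠ 0) :
    StieltjesPerronLimit I σ x
      (1 / offDiagonalCoeff I ρ P n ^ 2 * (ρ x / secondaryDenominator I ρ φ P n x)) := by
  obtain ⟨-, hS⟩ := stieltjes_nthSecondaryDensity hI hρ hmom hP (n + 1) σ hσ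
  obtain ⟨hm, hp⟩ := tendsto_stieltjes_boundary (hinv x hx) (hφ x hx)
  have hRm := fun m => tendsto_secondKind_boundary (P := P) hmom m (tendsto_ofReal_sub_I_mul x)
    (eventually_im_sub_I_mul_ne_zero x) hm
  have hRp := fun m => tendsto_secondKind_boundary (P := P) hmom m (tendsto_ofReal_add_I_mul x)
    (eventually_im_add_I_mul_ne_zero x) hp
  have hcas := casorati_secondaryPolynomial hρ hmom hP n hp
  have hDc : (secondaryDenominator I ρ φ P n x : ℂ) ≠ 0 := Complex.ofReal_ne_zero.mpr hD
  have hDeq := ofReal_secondaryDenominator (I := I) (ρ := ρ) (φ := φ) (P := P) (x := x) n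
  have hne := hDc
  rw [hDeq, mul_ne_zero_iff] at hne
  have ht0 : (offDiagonalCoeff I ρ P n : ℂ) ≠ 0 :=
    Complex.ofReal_ne_zero.mpr (offDiagonalCoeff_ne_zero hP hmom n)
  have hlim := (((hRm (n + 1)).div ((hRm n).const_mul (offDiagonalCoeff I ρ P n : ℂ))
    (mul_ne_zero ht0 hne.1)).sub ((hRp (n + 1)).div
      ((hRp n).const_mul (offDiagonalCoeff I ρ P n : ℂ)) (mul_ne_zero ht0 hne.2))).const_mul
        (1 / (2 * Complex.I * (Real.pi : ℂ)))
  have hval : 1 / (2 * Complex.I * (Real.pi : ℂ)) *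
      (((P (n + 1)).eval x * ((φ x : ℂ) / 2 + Complex.I * Real.pi * ρ x) -
          secondaryPolynomial I ρ (P (n + 1)) x) /
        (offDiagonalCoeff I ρ P n * ((P n).eval x * ((φ x : ℂ) / 2 + Complex.I * Real.pi * ρ x) -
          secondaryPolynomial I ρ (P n) x)) -
      ((P (n + 1)).eval x * ((φ x : ℂ) / 2 - Complex.I * Real.pi * ρ x) -
          secondaryPolynomial I ρ (P (n + 1)) x) /
        (offDiagonalCoeff I ρ P n * ((P n).eval x * ((φ x : ℂ) / 2 - Complex.I * Real.pi * ρ x) -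
          secondaryPolynomial I ρ (P n) x))) =
      ((1 / offDiagonalCoeff I ρ P n ^ 2 * (ρ x / secondaryDenominator I ρ φ P n x) : ℝ) : ℂ) := by
    push_cast
    rw [hDeq]
    obtain ⟨hne1, hne2⟩ := hne
    have hpi : (Real.pi : ℂ) ≠ 0 := Complex.ofReal_ne_zero.mpr Real.pi_ne_zero
    have hI0 := Complex.I_ne_zero
    generalize (secondaryPolynomial I ρ (P n) x : ℂ) = q at *
    generalize (secondaryPolynomial I ρ (P (n + 1)) x : ℂ) = q' at *
    generalize (((P n).eval x : ℝ) : ℂ) = p at *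
    generalize (((P (n + 1)).eval x : ℝ) : ℂ) = p' at *
    generalize (offDiagonalCoeff I ρ P n : ℂ) = t at *
    -- The terms in p p' and q q' cancel, leaving 2iπρ (p q' - p' q), and the bracket is 1/t by the
    -- Casorati identity.
    have hnum : (p' * ((φ x : ℂ) / 2 + Complex.I * Real.pi * ρ x) - q') *
          (p * ((φ x : ℂ) / 2 - Complex.I * Real.pi * ρ x) - q) -
        (p' * ((φ x : ℂ) / 2 - Complex.I * Real.pi * ρ x) - q') *
          (p * ((φ x : ℂ) / 2 + Complex.I * Real.pi * ρ x) - q) =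
        2 * Complex.I * Real.pi * ρ x / t := by
      field_simp
      linear_combination (8 * Complex.I * Real.pi * ρ x) * hcas
    generalize p' * ((φ x : ℂ) / 2 + Complex.I * Real.pi * ρ x) - q' = a at *
    generalize p' * ((φ x : ℂ) / 2 - Complex.I * Real.pi * ρ x) - q' = b at *
    generalize p * ((φ x : ℂ) / 2 + Complex.I * Real.pi * ρ x) - q = u at *
    generalize p * ((φ x : ℂ) / 2 - Complex.I * Real.pi * ρ x) - q = v at *
    have h1 : a / (t * u) - b / (t * v) = (a * v - b * u) / (t * (u * v)) := by
      field_simp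
    rw [h1, hnum]
    field_simp
  rw [hval] at hlim
  refine hlim.congr' ?_
  filter_upwards [eventually_im_sub_I_mul_ne_zero x, eventually_im_add_I_mul_ne_zero x]
    with ε h1 h2
  rw [hS _ h1, hS _ h2]
  rfl

/-- A sum of two real squares vanishes only if both do, so the boundary value of R_n from above is
zero. By the Casorati identity that of R_{n+1} is then nonzero, and the quotient blows up. -/
theorem tendsto_norm_stieltjes_atTop_of_secondaryDenominator_eq_zero (hI : MeasurableSet I)
    (hρ : IsProbabilityDensityOn I ρ)
    (hmom : ∀ k : ℕ, IntegrableOn (fun x => x ^ k * ρ x) I)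
    (hP : IsOrthonormalPolynomials I ρ P) (hinv : SatisfiesInversion I ρ)
    (hφ : IsReducer I ρ φ) {n : ℕ} {σ : ℝ → ℝ} (hσ : IsNthSecondaryDensity I ρ (n + 1) σ)
    (hx : x ∈ I) (hD : secondaryDenominator I ρ φ P n x = 0) :
    Tendsto (fun ε : ℝ => ‖stieltjes I σ (x + Complex.I * ε)‖) (𝓝[>] 0) atTop := by
  obtain ⟨hσ1, hS⟩ := stieltjes_nthSecondaryDensity hI hρ hmom hP (n + 1) σ hσ
  obtain ⟨-, hp⟩ := tendsto_stieltjes_boundary (hinv x hx) (hφ x hx)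
  have hRp := fun m => tendsto_secondKind_boundary (P := P) hmom m (tendsto_ofReal_add_I_mul x)
    (eventually_im_add_I_mul_ne_zero x) hp
  have hcas := casorati_secondaryPolynomial hρ hmom hP n hp
  have hzero : (((P n).eval x : ℝ) : ℂ) * ((φ x : ℂ) / 2 - Complex.I * Real.pi * ρ x) -
      secondaryPolynomial I ρ (P n) x = 0 := by
    obtain ⟨h1, h2⟩ := (add_eq_zero_iff_of_nonneg (sq_nonneg _) (by positivity)).mp hD
    have h1' := pow_eq_zero_iff (two_ne_zero) |>.mp h1
    have h2' : Real.pi * ρ x * (P n).eval x = 0 := by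
      rw [← mul_pow, ← mul_pow] at h2
      exact pow_eq_zero_iff (two_ne_zero) |>.mp h2
    have e1 := congrArg (fun r : ℝ => (r : ℂ)) h1'
    have e2 := congrArg (fun r : ℝ => (r : ℂ)) h2'
    push_cast at e1 e2
    linear_combination e1 - Complex.I * e2
  have hR0 := hRp n
  rw [hzero] at hR0
  have hne' : (((P (n + 1)).eval x : ℝ) : ℂ) * ((φ x : ℂ) / 2 - Complex.I * Real.pi * ρ x) -
      secondaryPolynomial I ρ (P (n + 1)) x ≠ 0 := by
    intro h
    have : (0 : ℂ) = 1 := by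
      linear_combination hcas + (offDiagonalCoeff I ρ P n : ℂ) * (((P n).eval x : ℝ) * h -
        ((P (n + 1)).eval x : ℝ) * hzero)
    exact zero_ne_one this
  -- The denominator never vanishes off the axis: otherwise division by zero would give S_σ = 0. Its
  -- norm therefore tends to 0 through positive values.
  have hden : Tendsto (fun ε : ℝ => ‖secondKindPred I ρ P (n + 1) (x + Complex.I * ε)‖) (𝓝[>] 0)
      (𝓝[>] 0) := by
    refine tendsto_nhdsWithin_iff.mpr ⟨?_, ?_⟩
    · have := (hR0.const_mul (offDiagonalCoeff I ρ P n : ℂ)).norm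
      rwa [mul_zero, norm_zero] at this
    · filter_upwards [eventually_im_add_I_mul_ne_zero x] with ε hε
      have := stieltjes_ne_zero hσ1 hI hε
      rw [hS _ hε] at this
      exact norm_pos_iff.mpr (div_ne_zero_iff.mp this).2
  have h1 := (hRp (n + 1)).norm.pos_mul_atTop (norm_pos_iff.mpr hne')
    (tendsto_inv_nhdsGT_zero.comp hden)
  refine h1.congr' ?_
  filter_upwards [eventually_im_add_I_mul_ne_zero x] with ε hε
  rw [hS _ hε, norm_div, div_eq_mul_inv]
  rfl

end BoundaryValues

/-! ### The main theorem. -/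

theorem mainTheorem1 (I : Set ℝ) (hI : I.OrdConnected) (ρ φ : ℝ → ℝ)
    (hρ : IsProbabilityDensityOn I ρ)
    (hmom : ∀ k : ℕ, IntegrableOn (fun x => x ^ k * ρ x) I)
    (hinv : SatisfiesInversion I ρ) (hφ : IsReducer I ρ φ)
    (P : ℕ → ℝ[X]) (hP : IsOrthonormalPolynomials I ρ P) :
    -- `t_k` and `s_k` are the coefficients of the three-term recurrence, and `t_k ≠ 0`
    ((X * P 0 = C (offDiagonalCoeff I ρ P 0) * P 1 + C (diagonalCoeff I ρ P 0) * P 0) ∧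
      (∀ k : ℕ, X * P (k + 1) =
        C (offDiagonalCoeff I ρ P (k + 1)) * P (k + 2) +
          C (diagonalCoeff I ρ P (k + 1)) * P (k + 1) + C (offDiagonalCoeff I ρ P k) * P k) ∧
      ∀ k : ℕ, offDiagonalCoeff I ρ P k ≠ 0) ∧
    -- the explicit formula for every `n`-th normalized secondary density `σ = ρ_n`, `n ≥ 1`
    ∀ (n : ℕ) (σ : ℝ → ℝ), 1 ≤ n → IsNthSecondaryDensity I ρ n σ →
      (∀ᵐ x ∂(volume.restrict I),
        secondaryDenominator I ρ φ P (n - 1) x ≠ 0 ∧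
        σ x = 1 / offDiagonalCoeff I ρ P (n - 1) ^ 2 *
          (ρ x / secondaryDenominator I ρ φ P (n - 1) x)) ∧
      ∀ x ∈ I, secondaryDenominator I ρ φ P (n - 1) x ≠ 0 →
        StieltjesPerronLimit I σ x
          (1 / offDiagonalCoeff I ρ P (n - 1) ^ 2 *
            (ρ x / secondaryDenominator I ρ φ P (n - 1) x)) := by
  have hIm : MeasurableSet I := hI.measurableSet
  refine ⟨⟨three_term_recurrence_zero hP hmom, three_term_recurrence_succ hP hmom,
    offDiagonalCoeff_ne_zero hP hmom⟩, fun n σ hn hσ => ?_⟩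
  obtain ⟨n, rfl⟩ : ∃ m, n = m + 1 := ⟨n - 1, by omega⟩
  rw [Nat.add_sub_cancel]
  have hSP : ∀ x ∈ I, secondaryDenominator I ρ φ P n x ≠ 0 → StieltjesPerronLimit I σ x
      (1 / offDiagonalCoeff I ρ P n ^ 2 * (ρ x / secondaryDenominator I ρ φ P n x)) :=
    fun x hx hD => stieltjesPerronLimit_nthSecondaryDensity hIm hρ hmom hP hinv hφ hσ hx hD
  refine ⟨?_, hSP⟩
  obtain ⟨hσ1, -⟩ := stieltjes_nthSecondaryDensity hIm hρ hmom hP (n + 1) σ hσ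
  -- Two null sets are discarded: where inversion fails for σ, and where |S_σ| tends to infinity.
  -- Elsewhere D ≠ 0, and σ x equals the explicit value by uniqueness of the Stieltjes–Perron limit.
  filter_upwards [ae_restrict_mem hIm, ae_stieltjesPerronLimit hIm hσ1.integrableOn,
    ae_restrict_of_ae (ae_not_tendsto_norm_stieltjes_atTop hσ1 hIm)] with x hx hlim hgrowth
  have hD : secondaryDenominator I ρ φ P n x ≠ 0 := fun h =>
    hgrowth (tendsto_norm_stieltjes_atTop_of_secondaryDenominator_eq_zero hIm hρ hmom hP hinv hφ
      hσ hx h)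
  exact ⟨hD, Complex.ofReal_injective (tendsto_nhds_unique hlim (hSP x hx hD))⟩
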